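/- Let $k$ be a field and let $\Lambda$ be a finite dimensional Hopf algebra over $k$ which is split (the endomorphism ring of each simple left module is isomorphic to $k$), basic (each simple module has multiplicity one in $\Lambda/\mathrm{rad}\,\Lambda$), and not semisimple. Modules are finitely generated left $\Lambda$-modules, and $M\otimes N=M\otimes_k N$ is a $\Lambda$-module through the comultiplication. Let $K_0(\Lambda)$ be the free abelian group on the isomorphism classes $[M]$ of modules, divided by the subgroup generated by the elements $[X_2]-[X_1]-[X_3]$ given by split exact sequences $0\to X_1\to X_2\to X_3\to 0$; it is a ring with $[M][N]=[M\otimes N]$. Let $K_0^p(\Lambda)\subseteq K_0(\Lambda)$ be the subring generated by the classes of semisimple modules and of projective modules. Let $\mathcal S$ be the structure group of $\Lambda$ (not necessarily abelian): the group of isomorphism classes of simple modules under the tensor product, whose unit is the class of the trivial module $k_\varepsilon$ and whose inverse is given by the dual module. Let $c\in\mathbf Z\mathcal S$ be the canonical element: the sum of the classes of the factors of a composition series of the projective cover of $k_\varepsilon$. Then $K_0^p(\Lambda)$ is a ring isomorphic to $\mathbf Z\mathcal S\oplus\mathbf Z\mathcal S$, where the first factor is the group ring and the multiplication is given by $$(s_1,t_1)(s_2,t_2)=(s_1s_2,\;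 s_1t_2+t_1s_2+t_1ct_2).$$ More precisely, there is a ring isomorphism that sends $[S]$ to $([S],0)$ and $[P_S]$ to $(0,[S])$ for each simple module $S$ with projective cover $P_S$. -/

import Mathlib

open scoped TensorProduct

universe u

noncomputable section

namespace HopfK

/-! ### Tensor products, the trivial module and duals of modules over a Hopf algebra -/

section RawModules

variable (k Λ M N P : Type u) [Field k] [Ring Λ] [HopfAlgebra k Λ]
  [AddCommGroup M] [Module k M] [Module Λ M] [IsScalarTower k Λ M]
  [AddCommGroup N] [Module k N] [Module Λ N] [IsScalarTower k Λ N]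
  [AddCommGroup P] [Module k P] [Module Λ P] [IsScalarTower k Λ P]

/-- The action of `Λ` on `M ⊗ N` through the comultiplication: if `Δ a = ∑ a₁ ⊗ a₂`, then `a` acts
by `m ⊗ n ↦ ∑ a₁ m ⊗ a₂ n`. -/
def tensorAction : Λ →ₐ[k] Module.End k (M ⊗[k] N) :=
  (Module.endTensorEndAlgHom (R := k) (S := k) (A := k) (M := M) (N := N)).comp
    ((Algebra.TensorProduct.map (Algebra.lsmul k k M) (Algebra.lsmul k k N)).comp
      (Bialgebra.comulAlgHom k Λ))

/-- The vector space `M ⊗ N` over `k`, as a type carrying the diagonal action of `Λ`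
(and not the action on the left factor). -/
def HopfTensor (_k _Λ M N : Type u) [Field _k] [Ring _Λ] [HopfAlgebra _k _Λ]
    [AddCommGroup M] [Module _k M] [AddCommGroup N] [Module _k N] : Type u := M ⊗[_k] N

instance : AddCommGroup (HopfTensor k Λ M N) := inferInstanceAs (AddCommGroup (M ⊗[k] N))

instance HopfTensor.baseModule : Module k (HopfTensor k Λ M N) :=
  inferInstanceAs (Module k (M ⊗[k] N))

instance HopfTensor.hopfModule : Module Λ (HopfTensor k Λ M N) :=
  Module.compHom (M ⊗[k] N) (tensorAction k Λ M N).toRingHom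

/-- The trivial module `k_ε`: the ground field, `a` acting by `ε a`. -/
def TrivialMod (_k _Λ : Type u) [Field _k] [Ring _Λ] [HopfAlgebra _k _Λ] : Type u := _k

instance : AddCommGroup (TrivialMod k Λ) := inferInstanceAs (AddCommGroup k)

instance TrivialMod.baseModule : Module k (TrivialMod k Λ) := inferInstanceAs (Module k k)

instance TrivialMod.hopfModule : Module Λ (TrivialMod k Λ) :=
  Module.compHom k (Bialgebra.counitAlgHom k Λ).toRingHom

/-- The left action of `Λ` on `Hom_k(M, k)`: `(a f)(m) = f (S(a) m)`, with `S` the antipode. -/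
def dualAction : Λ →ₐ[k] Module.End k (M →ₗ[k] k) :=
  AlgHom.ofLinearMap
    ((LinearMap.llcomp k M M k).flip ∘ₗ
      (Algebra.lsmul k k M).toLinearMap ∘ₗ HopfAlgebra.antipode k)
    (by ext f m; simp)
    (fun a b => by ext f m; simp [HopfAlgebra.antipode_mul_antidistrib])

/-- The dual `Hom_k(M, k)`, as a type carrying the left action of `Λ` through the antipode. -/
def DualMod (_k _Λ M : Type u) [Field _k] [Ring _Λ] [HopfAlgebra _k _Λ]
    [AddCommGroup M] [Module _k M] : Type u := M →ₗ[_k] _k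

instance : AddCommGroup (DualMod k Λ M) := inferInstanceAs (AddCommGroup (M →ₗ[k] k))

instance DualMod.baseModule : Module k (DualMod k Λ M) := inferInstanceAs (Module k (M →ₗ[k] k))

instance DualMod.hopfModule : Module Λ (DualMod k Λ M) :=
  Module.compHom (M →ₗ[k] k) (dualAction k Λ M).toRingHom

instance : IsScalarTower k Λ (HopfTensor k Λ M N) :=
  IsScalarTower.of_algebraMap_smul fun r t => by
    change tensorAction k Λ M N (algebraMap k Λ r) (show M ⊗[k] N from t) =
      r • (show M ⊗[k] N from t)
    rw [AlgHom.commutes]; rfl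

instance : IsScalarTower k Λ (TrivialMod k Λ) :=
  IsScalarTower.of_algebraMap_smul fun r t => by
    change Bialgebra.counitAlgHom k Λ (algebraMap k Λ r) * (show k from t) = r * (show k from t)
    rw [AlgHom.commutes]; rfl

instance : IsScalarTower k Λ (DualMod k Λ M) :=
  IsScalarTower.of_algebraMap_smul fun r f => by
    change dualAction k Λ M (algebraMap k Λ r) (show M →ₗ[k] k from f) =
      r • (show M →ₗ[k] k from f)
    rw [AlgHom.commutes]; rfl

/-- The map `a ↦ a m`. -/
abbrev orb (k : Type u) {Λ M : Type u} [Field k] [Ring Λ] [Algebra k Λ] [AddCommGroup M] [Module k M]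
    [Module Λ M] [IsScalarTower k Λ M] (m : M) : Λ →ₗ[k] M :=
  (LinearMap.toSpanSingleton Λ M m).restrictScalars k

variable {k Λ M N P}

theorem tensorAction_tmul (a : Λ) (m : M) (n : N) :
    tensorAction k Λ M N a (m ⊗ₜ[k] n) =
      TensorProduct.map (orb k m) (orb k n) (Coalgebra.comul (R := k) a) := by
  change Module.endTensorEndAlgHom (R := k) (S := k) (A := k) (M := M) (N := N)
    (Algebra.TensorProduct.map (Algebra.lsmul k k M) (Algebra.lsmul k k N)
      (Coalgebra.comul (R := k) a)) (m ⊗ₜ[k] n) = _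
  induction Coalgebra.comul (R := k) a using TensorProduct.induction_on with
  | zero => simp
  | tmul x y => simp [Module.endTensorEndAlgHom_apply]
  | add x y hx hy => simp only [map_add, LinearMap.add_apply, hx, hy]

/-- Equivariance of a linear map out of `M ⊗ N` can be checked on pure tensors. -/
theorem map_tensorAction {Q : Type u} [AddCommGroup Q] [Module k Q]
    (e : M ⊗[k] N →ₗ[k] Q) (α : Λ → Q →+ Q)
    (h : ∀ (a : Λ) (m : M) (n : N),
      e (TensorProduct.map (orb k m) (orb k n) (Coalgebra.comul (R := k) a)) = α a (e (m ⊗ₜ[k] n)))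
    (a : Λ) (t : M ⊗[k] N) : e (tensorAction k Λ M N a t) = α a (e t) := by
  induction t using TensorProduct.induction_on with
  | zero => simp
  | tmul m n => rw [← h, tensorAction_tmul]
  | add x y hx hy => simp only [map_add, hx, hy]

variable {M' N' : Type u} [AddCommGroup M'] [Module k M'] [Module Λ M'] [IsScalarTower k Λ M']
  [AddCommGroup N'] [Module k N'] [Module Λ N'] [IsScalarTower k Λ N']

def tensorCongr (e : M ≃ₗ[Λ] M') (f : N ≃ₗ[Λ] N') :
    HopfTensor k Λ M N ≃ₗ[Λ] HopfTensor k Λ M' N' :=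
  { (TensorProduct.congr (e.restrictScalars k) (f.restrictScalars k)).toAddEquiv with
    map_smul' := map_tensorAction
      (TensorProduct.congr (e.restrictScalars k) (f.restrictScalars k)).toLinearMap
      (fun a => (tensorAction k Λ M' N' a).toAddMonoidHom) fun a m n => by
        simp only [LinearEquiv.coe_coe, LinearMap.toAddMonoidHom_coe, TensorProduct.congr_tmul,
          tensorAction_tmul]
        induction Coalgebra.comul (R := k) a using TensorProduct.induction_on with
        | zero => simp
        | tmul x y => simp
        | add x y hx hy => simp only [map_add, hx, hy] }

def tensorProdRight :
    HopfTensor k Λ M (N × P) ≃ₗ[Λ] HopfTensor k Λ M N × HopfTensor k Λ M P :=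
  { (TensorProduct.prodRight k k M N P).toAddEquiv with
    map_smul' := map_tensorAction
      (TensorProduct.prodRight k k M N P).toLinearMap
      (fun a => ((tensorAction k Λ M N a).prodMap (tensorAction k Λ M P a)).toAddMonoidHom)
      fun a m x => by
        simp only [LinearEquiv.coe_coe, LinearMap.toAddMonoidHom_coe,
          TensorProduct.prodRight_tmul, LinearMap.prodMap_apply, tensorAction_tmul]
        induction Coalgebra.comul (R := k) a using TensorProduct.induction_on with
        | zero => simp [Prod.ext_iff]
        | tmul x y => simp
        | add x y hx hy => simp only [map_add, hx, hy, Prod.mk_add_mk] }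

def tensorProdLeft :
    HopfTensor k Λ (M × N) P ≃ₗ[Λ] HopfTensor k Λ M P × HopfTensor k Λ N P :=
  { (TensorProduct.prodLeft k k M N P).toAddEquiv with
    map_smul' := map_tensorAction
      (TensorProduct.prodLeft k k M N P).toLinearMap
      (fun a => ((tensorAction k Λ M P a).prodMap (tensorAction k Λ N P a)).toAddMonoidHom)
      fun a x p => by
        obtain ⟨m, n⟩ := x
        simp only [LinearEquiv.coe_coe, LinearMap.toAddMonoidHom_coe,
          TensorProduct.prodLeft_tmul, LinearMap.prodMap_apply, tensorAction_tmul]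
        induction Coalgebra.comul (R := k) a using TensorProduct.induction_on with
        | zero => simp [Prod.ext_iff]
        | tmul x y => simp
        | add x y hx hy => simp only [map_add, hx, hy, Prod.mk_add_mk] }

theorem orb_trivial (r : TrivialMod k Λ) (a : Λ) :
    orb k r a = Coalgebra.counit (R := k) a • r := rfl

/-- The map `a ⊗ b ↦ a m ⊗ b n`. -/
def orbTwo (m : M) (n : N) : Λ ⊗[k] Λ →ₗ[k] HopfTensor k Λ M N :=
  TensorProduct.map (orb k m) (orb k n)

/-- The pure tensor `m ⊗ n` as an element of the tensor product of modules. -/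
def tmk (k Λ : Type u) {M N : Type u} [Field k] [Ring Λ] [HopfAlgebra k Λ]
    [AddCommGroup M] [Module k M] [AddCommGroup N] [Module k N] (m : M) (n : N) :
    HopfTensor k Λ M N := m ⊗ₜ[k] n

theorem orb_tmk (m : M) (n : N) (a : Λ) :
    orb k (tmk k Λ m n) a = orbTwo m n (Coalgebra.comul (R := k) a) :=
  tensorAction_tmul a m n

/-- The underlying linear isomorphism of `k_ε ⊗ M ≅ M`. -/
def lidAux : TrivialMod k Λ ⊗[k] M ≃ₗ[k] M := TensorProduct.lid k M

def tensorUnitLeft : HopfTensor k Λ (TrivialMod k Λ) M ≃ₗ[Λ] M :=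
  { (lidAux (k := k) (Λ := Λ) (M := M)).toAddEquiv with
    map_smul' := map_tensorAction
      (lidAux (k := k) (Λ := Λ) (M := M)).toLinearMap
      (fun a => (Algebra.lsmul k k M a).toAddMonoidHom) fun a r m => by
        have key : ∀ t : Λ ⊗[k] Λ, lidAux (TensorProduct.map (orb k r) (orb k m) t) =
            (show k from r) • orb k m
              (TensorProduct.lid k Λ ((Coalgebra.counit (R := k) (A := Λ)).rTensor Λ t)) := by
          intro t
          induction t using TensorProduct.induction_on with
          | zero => simp only [map_zero]; exact (smul_zero (show k from r)).symm
          | tmul x y =>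
            rw [TensorProduct.map_tmul, LinearMap.rTensor_tmul,
              TensorProduct.lid_tmul, map_smul, smul_smul, mul_comm]
            rfl
          | add x y hx hy =>
            simp only [map_add, hx, hy]; exact (smul_add (show k from r) _ _).symm
        refine (key _).trans ?_
        rw [Coalgebra.rTensor_counit_comul, TensorProduct.lid_tmul, one_smul]
        exact (smul_comm a (show k from r) m).symm }

/-- The underlying linear isomorphism of `M ⊗ k_ε ≅ M`. -/
def ridAux : M ⊗[k] TrivialMod k Λ ≃ₗ[k] M := TensorProduct.rid k M

def tensorUnitRight : HopfTensor k Λ M (TrivialMod k Λ) ≃ₗ[Λ] M :=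
  { (ridAux (k := k) (Λ := Λ) (M := M)).toAddEquiv with
    map_smul' := map_tensorAction
      (ridAux (k := k) (Λ := Λ) (M := M)).toLinearMap
      (fun a => (Algebra.lsmul k k M a).toAddMonoidHom) fun a m r => by
        have key : ∀ t : Λ ⊗[k] Λ, ridAux (TensorProduct.map (orb k m) (orb k r) t) =
            (show k from r) • orb k m
              (TensorProduct.rid k Λ ((Coalgebra.counit (R := k) (A := Λ)).lTensor Λ t)) := by
          intro t
          induction t using TensorProduct.induction_on with
          | zero => simp only [map_zero]; exact (smul_zero (show k from r)).symm
          | tmul x y =>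
            rw [TensorProduct.map_tmul, LinearMap.lTensor_tmul,
              TensorProduct.rid_tmul, map_smul, smul_smul, mul_comm]
            rfl
          | add x y hx hy =>
            simp only [map_add, hx, hy]; exact (smul_add (show k from r) _ _).symm
        refine (key _).trans ?_
        rw [Coalgebra.lTensor_counit_comul, TensorProduct.rid_tmul, one_smul]
        exact (smul_comm a (show k from r) m).symm }

/-- The underlying linear isomorphism of the associativity isomorphism. -/
def assocAux : HopfTensor k Λ M N ⊗[k] P ≃ₗ[k] M ⊗[k] HopfTensor k Λ N P :=
  TensorProduct.assoc k M N P

theorem assocAux_map (m : M) (n : N) (p : P) (t : Λ ⊗[k] Λ) :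
    assocAux (TensorProduct.map (orb k (tmk k Λ m n)) (orb k p) t) =
      TensorProduct.map (orb k m) (orbTwo n p)
        (TensorProduct.assoc k Λ Λ Λ ((Coalgebra.comul (R := k) (A := Λ)).rTensor Λ t)) := by
  induction t using TensorProduct.induction_on with
  | zero => simp only [map_zero]
  | tmul x y =>
    rw [TensorProduct.map_tmul, orb_tmk, LinearMap.rTensor_tmul]
    induction Coalgebra.comul (R := k) x using TensorProduct.induction_on with
    | zero => simp only [map_zero, TensorProduct.zero_tmul]
    | tmul z w => rfl
    | add z w hz hw => simp only [map_add, TensorProduct.add_tmul, hz, hw]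
  | add x y hx hy => simp only [map_add, hx, hy]

theorem map_orb_tmk (m : M) (n : N) (p : P) (t : Λ ⊗[k] Λ) :
    TensorProduct.map (orb k m) (orb k (tmk k Λ n p)) t =
      TensorProduct.map (orb k m) (orbTwo n p)
        ((Coalgebra.comul (R := k) (A := Λ)).lTensor Λ t) := by
  induction t using TensorProduct.induction_on with
  | zero => simp only [map_zero]
  | tmul x y => rw [TensorProduct.map_tmul, orb_tmk, LinearMap.lTensor_tmul, TensorProduct.map_tmul]
  | add x y hx hy => simp only [map_add, hx, hy]

theorem assocAux_smul (a : Λ) (x : HopfTensor k Λ M N) (p : P) :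
    assocAux (tensorAction k Λ (HopfTensor k Λ M N) P a (x ⊗ₜ[k] p)) =
      tensorAction k Λ M (HopfTensor k Λ N P) a (assocAux (x ⊗ₜ[k] p)) := by
  let F : HopfTensor k Λ M N →ₗ[k] M ⊗[k] HopfTensor k Λ N P :=
    assocAux.toLinearMap ∘ₗ tensorAction k Λ (HopfTensor k Λ M N) P a ∘ₗ
      (TensorProduct.mk k (HopfTensor k Λ M N) P).flip p
  let G : HopfTensor k Λ M N →ₗ[k] M ⊗[k] HopfTensor k Λ N P :=
    tensorAction k Λ M (HopfTensor k Λ N P) a ∘ₗ assocAux.toLinearMap ∘ₗ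
      (TensorProduct.mk k (HopfTensor k Λ M N) P).flip p
  suffices h : F = G from LinearMap.congr_fun h x
  refine TensorProduct.ext' (M := M) (N := N) fun m n => ?_
  change assocAux (tensorAction k Λ (HopfTensor k Λ M N) P a (tmk k Λ m n ⊗ₜ[k] p)) =
    tensorAction k Λ M (HopfTensor k Λ N P) a (m ⊗ₜ[k] tmk k Λ n p)
  rw [tensorAction_tmul, tensorAction_tmul, assocAux_map, Coalgebra.coassoc_apply, map_orb_tmk]

def tensorAssoc :
    HopfTensor k Λ (HopfTensor k Λ M N) P ≃ₗ[Λ] HopfTensor k Λ M (HopfTensor k Λ N P) :=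
  { (assocAux (k := k) (Λ := Λ) (M := M) (N := N) (P := P)).toAddEquiv with
    map_smul' := map_tensorAction
      (assocAux (k := k) (Λ := Λ) (M := M) (N := N) (P := P)).toLinearMap
      (fun a => (tensorAction k Λ M (HopfTensor k Λ N P) a).toAddMonoidHom) fun a x p => by
        rw [← tensorAction_tmul]; exact assocAux_smul a x p }

/-- Evaluation `M^* ⊗ M → k`. -/
def evalAux : DualMod k Λ M ⊗[k] M →ₗ[k] TrivialMod k Λ := TensorProduct.lift LinearMap.id

def dualEval : HopfTensor k Λ (DualMod k Λ M) M →ₗ[Λ] TrivialMod k Λ :=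
  { (evalAux (k := k) (Λ := Λ) (M := M)).toAddMonoidHom with
    map_smul' := map_tensorAction
      (evalAux (k := k) (Λ := Λ) (M := M))
      (fun a => (Algebra.lsmul k k (TrivialMod k Λ) a).toAddMonoidHom) fun a f m => by
        have key : ∀ t : Λ ⊗[k] Λ, evalAux (TensorProduct.map (orb k f) (orb k m) t) =
            (show M →ₗ[k] k from f) (orb k m
              (LinearMap.mul' k Λ ((HopfAlgebra.antipode k (A := Λ)).rTensor Λ t))) := by
          intro t
          induction t using TensorProduct.induction_on with
          | zero => simp only [map_zero]; exact (map_zero (show M →ₗ[k] k from f)).symm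
          | tmul x y =>
            rw [TensorProduct.map_tmul, LinearMap.rTensor_tmul, LinearMap.mul'_apply]
            change (show M →ₗ[k] k from f) (HopfAlgebra.antipode k x • y • m) = _
            rw [← mul_smul]; rfl
          | add x y hx hy =>
            simp only [map_add, hx, hy]; exact (map_add (show M →ₗ[k] k from f) _ _).symm
        refine (key _).trans ?_
        rw [HopfAlgebra.mul_antipode_rTensor_comul_apply]
        change (show M →ₗ[k] k from f) (algebraMap k Λ _ • m) = _
        rw [algebraMap_smul, map_smul]
        rfl }

/-- Isomorphic modules have isomorphic duals. -/
def dualCongr (e : M ≃ₗ[Λ] N) : DualMod k Λ M ≃ₗ[Λ] DualMod k Λ N :=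
  { (LinearEquiv.congrLeft k k (e.restrictScalars k)).toAddEquiv with
    map_smul' := fun a f => by
      refine @LinearMap.ext k k N k _ _ _ _ _ _ _ _ _ fun n => ?_
      change (show M →ₗ[k] k from f) (HopfAlgebra.antipode k a • e.symm n) =
        (show M →ₗ[k] k from f) (e.symm (HopfAlgebra.antipode k a • n))
      rw [map_smul e.symm] }

end RawModules

instance (k Λ M N : Type u) [Field k] [Ring Λ] [HopfAlgebra k Λ]
    [AddCommGroup M] [Module k M] [AddCommGroup N] [Module k N]
    [Module.Finite k M] [Module.Finite k N] : Module.Finite k (HopfTensor k Λ M N) :=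
  inferInstanceAs (Module.Finite k (M ⊗[k] N))

instance (k Λ : Type u) [Field k] [Ring Λ] [HopfAlgebra k Λ] :
    Module.Finite k (TrivialMod k Λ) := inferInstanceAs (Module.Finite k k)

instance (k Λ M : Type u) [Field k] [Ring Λ] [HopfAlgebra k Λ] [AddCommGroup M] [Module k M]
    [Module.Finite k M] : Module.Finite k (DualMod k Λ M) :=
  inferInstanceAs (Module.Finite k (M →ₗ[k] k))

/-! ### Finite dimensional modules and their isomorphism classes -/

/-- A finite dimensional left `Λ`-module. If `Λ` is finite dimensional over `k`, these are exactly
the finitely generated left `Λ`-modules (the vector space structure being the one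
induced by `k → Λ`). -/
structure FDMod (k Λ : Type u) [Field k] [Ring Λ] [Algebra k Λ] : Type (u + 1) where
  carrier : Type u
  [addCommGroup : AddCommGroup carrier]
  [baseModule : Module k carrier]
  [module : Module Λ carrier]
  [isScalarTower : IsScalarTower k Λ carrier]
  [finite : Module.Finite k carrier]

attribute [instance] FDMod.addCommGroup FDMod.baseModule FDMod.module FDMod.isScalarTower
  FDMod.finite

instance (k Λ : Type u) [Field k] [Ring Λ] [Algebra k Λ] : CoeSort (FDMod k Λ) (Type u) :=
  ⟨FDMod.carrier⟩

/-- Isomorphism of `Λ`-modules. -/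
instance isoSetoid (k Λ : Type u) [Field k] [Ring Λ] [Algebra k Λ] : Setoid (FDMod k Λ) where
  r M N := Nonempty (M ≃ₗ[Λ] N)
  iseqv := ⟨fun _ => ⟨.refl _ _⟩, fun ⟨e⟩ => ⟨e.symm⟩, fun ⟨e⟩ ⟨f⟩ => ⟨e.trans f⟩⟩

/-- Isomorphism classes of finitely generated left `Λ`-modules. -/
def IsoClass (k Λ : Type u) [Field k] [Ring Λ] [Algebra k Λ] : Type (u + 1) :=
  Quotient (isoSetoid k Λ)

section Iso

variable {k Λ : Type u} [Field k] [Ring Λ]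

/-- The isomorphism class of a module. -/
def FDMod.cls [Algebra k Λ] (M : FDMod k Λ) : IsoClass k Λ := Quotient.mk _ M

/-- The direct sum. -/
def FDMod.prod [Algebra k Λ] (M N : FDMod k Λ) : FDMod k Λ := ⟨M × N⟩

variable [HopfAlgebra k Λ]

/-- The tensor product. -/
def FDMod.tensor (M N : FDMod k Λ) : FDMod k Λ := ⟨HopfTensor k Λ M N⟩

/-- The dual. -/
def FDMod.dual (M : FDMod k Λ) : FDMod k Λ := ⟨DualMod k Λ M⟩

variable (k Λ) in
/-- The trivial module `k_ε`. -/
def FDMod.triv : FDMod k Λ := ⟨TrivialMod k Λ⟩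

theorem cls_eq {M N : FDMod k Λ} (e : M ≃ₗ[Λ] N) : M.cls = N.cls := Quotient.sound ⟨e⟩

/-- Isomorphism classes form a monoid under the tensor product, with unit the class of `k_ε`. -/
instance : Monoid (IsoClass k Λ) where
  mul := Quotient.map₂ FDMod.tensor fun _ _ ⟨e⟩ _ _ ⟨f⟩ => ⟨tensorCongr e f⟩
  one := (FDMod.triv k Λ).cls
  mul_assoc := by
    rintro ⟨M⟩ ⟨N⟩ ⟨P⟩
    exact cls_eq (M := (M.tensor N).tensor P) (N := M.tensor (N.tensor P)) tensorAssoc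
  one_mul := by
    rintro ⟨M⟩
    exact cls_eq (M := (FDMod.triv k Λ).tensor M) (tensorUnitLeft (k := k) (M := M))
  mul_one := by
    rintro ⟨M⟩
    exact cls_eq (M := M.tensor (FDMod.triv k Λ)) (tensorUnitRight (k := k) (M := M))

theorem cls_mul (M N : FDMod k Λ) : M.cls * N.cls = (M.tensor N).cls := rfl

end Iso

/-! ### The Grothendieck ring and the projective class ring -/

section K0

variable (k Λ : Type u) [Field k] [Ring Λ] [HopfAlgebra k Λ]

/-- The subgroup of the free abelian group on isomorphism classes generated by the elements
`[X₁ ⊕ X₃] - [X₁] - [X₃]`, that is, by the split exact sequences. -/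
def splitRelations : AddSubgroup (FreeAbelianGroup (IsoClass k Λ)) :=
  AddSubgroup.closure {x | ∃ X Y : FDMod k Λ, x = FreeAbelianGroup.of (X.prod Y).cls -
    FreeAbelianGroup.of X.cls - FreeAbelianGroup.of Y.cls}

/-- The subgroup generated by the split exact sequences, as an ideal. -/
def splitIdeal : Ideal (FreeAbelianGroup (IsoClass k Λ)) where
  carrier := splitRelations k Λ
  zero_mem' := zero_mem _
  add_mem' := add_mem
  smul_mem' := fun c x hx => by
    change c * x ∈ splitRelations k Λ
    change x ∈ splitRelations k Λ at hx
    induction hx using AddSubgroup.closure_induction with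
    | zero => rw [mul_zero]; exact zero_mem _
    | add x y _ _ hx hy => rw [mul_add]; exact add_mem hx hy
    | neg x _ hx => rw [mul_neg]; exact neg_mem hx
    | mem x hx =>
      obtain ⟨X, Y, rfl⟩ := hx
      induction c using FreeAbelianGroup.induction_on with
      | zero => rw [zero_mul]; exact zero_mem _
      | add x y hx hy => rw [add_mul]; exact add_mem hx hy
      | neg x hx => rw [neg_mul]; exact neg_mem hx
      | of Z =>
        obtain ⟨Z, rfl⟩ : ∃ M : FDMod k Λ, M.cls = Z := Quotient.exists_rep Z
        refine AddSubgroup.subset_closure ⟨Z.tensor X, Z.tensor Y, ?_⟩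
        simp only [mul_sub, FreeAbelianGroup.of_mul_of, cls_mul]
        rw [cls_eq (M := Z.tensor (X.prod Y)) (N := (Z.tensor X).prod (Z.tensor Y))
          tensorProdRight]

instance : (splitIdeal k Λ).IsTwoSided where
  mul_mem_of_left {x} c hx := by
    change x * c ∈ splitRelations k Λ
    change x ∈ splitRelations k Λ at hx
    induction hx using AddSubgroup.closure_induction with
    | zero => rw [zero_mul]; exact zero_mem _
    | add x y _ _ hx hy => rw [add_mul]; exact add_mem hx hy
    | neg x _ hx => rw [neg_mul]; exact neg_mem hx
    | mem x hx =>
      obtain ⟨X, Y, rfl⟩ := hx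
      induction c using FreeAbelianGroup.induction_on with
      | zero => rw [mul_zero]; exact zero_mem _
      | add x y hx hy => rw [mul_add]; exact add_mem hx hy
      | neg x hx => rw [mul_neg]; exact neg_mem hx
      | of Z =>
        obtain ⟨Z, rfl⟩ : ∃ M : FDMod k Λ, M.cls = Z := Quotient.exists_rep Z
        refine AddSubgroup.subset_closure ⟨X.tensor Z, Y.tensor Z, ?_⟩
        simp only [sub_mul, FreeAbelianGroup.of_mul_of, cls_mul]
        rw [cls_eq (M := (X.prod Y).tensor Z) (N := (X.tensor Z).prod (Y.tensor Z))
          tensorProdLeft]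

/-- The Grothendieck ring `K₀(Λ)` of finitely generated left modules modulo split exact sequences,
with multiplication given by the tensor product. -/
abbrev K0 : Type (u + 1) := FreeAbelianGroup (IsoClass k Λ) ⧸ splitIdeal k Λ

variable {k Λ} in
/-- The element `[M]` of `K₀(Λ)`. -/
def FDMod.toK0 (M : FDMod k Λ) : K0 k Λ :=
  Ideal.Quotient.mk (splitIdeal k Λ) (FreeAbelianGroup.of M.cls)

/-- The projective class ring `K₀ᵖ(Λ)`: the subring of `K₀(Λ)` generated by the classes of
semisimple and of projective modules. -/
def K0p : Subring (K0 k Λ) :=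
  Subring.closure {x | ∃ M : FDMod k Λ,
    (IsSemisimpleModule Λ M ∨ Module.Projective Λ M) ∧ x = M.toK0}

end K0

/-! ### Basic and split Hopf algebras and the structure group -/

section Basic

/-- Split: the endomorphism ring of each simple module is isomorphic to the ground field. -/
class IsSplitAlgebra (k Λ : Type u) [Field k] [Ring Λ] [Algebra k Λ] : Prop where
  nonempty_end_equiv (M : FDMod k Λ) (hM : IsSimpleModule Λ M) :
    Nonempty (Module.End Λ M ≃ₐ[k] k)

/-- Basic: each simple module has multiplicity one in the maximal semisimple quotient `Λ / rad Λ`,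
that is, its isotypic component there consists of a single copy. -/
class IsBasicAlgebra (k Λ : Type u) [Field k] [Ring Λ] [Algebra k Λ] : Prop where
  nonempty_isotypic_equiv (M : FDMod k Λ) (hM : IsSimpleModule Λ M) :
    Nonempty (isotypicComponent Λ (Λ ⧸ Ring.jacobson Λ) M ≃ₗ[Λ] M)

variable {k Λ : Type u} [Field k] [Ring Λ]

theorem isSimple_of_finrank [Algebra k Λ] (M : FDMod k Λ) (h : Module.finrank k M = 1) :
    IsSimpleModule Λ M := by
  have hs : IsSimpleModule k M := isSimpleModule_iff_finrank_eq_one.mpr h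
  have : Nontrivial M := IsSimpleModule.nontrivial k M
  refine { eq_bot_or_eq_top := fun N => ?_ }
  rcases eq_bot_or_eq_top (N.restrictScalars k) with h | h
  · left; exact (Submodule.restrictScalars_eq_bot_iff k Λ M).mp h
  · right; exact (Submodule.restrictScalars_eq_top_iff k Λ M).mp h

/-- Over a basic and split algebra the simple modules are one-dimensional. -/
theorem finrank_of_isSimple [Algebra k Λ] [Module.Finite k Λ] [IsSplitAlgebra k Λ]
    [IsBasicAlgebra k Λ] (M : FDMod k Λ) (hM : IsSimpleModule Λ M) : Module.finrank k M = 1 := by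
  obtain ⟨φ⟩ := IsSplitAlgebra.nonempty_end_equiv M hM
  obtain ⟨e⟩ := IsBasicAlgebra.nonempty_isotypic_equiv M hM
  have : IsArtinianRing Λ := IsArtinianRing.of_finite k Λ
  have hss : IsSemisimpleModule Λ (Λ ⧸ Ring.jacobson Λ) :=
    (IsArtinian.isSemisimpleModule_iff_jacobson Λ _).mpr (Module.jacobson_quotient_jacobson Λ Λ)
  have hle : ∀ m : M, Ring.jacobson Λ ≤ LinearMap.ker (LinearMap.toSpanSingleton Λ M m) :=
    fun m => IsSemisimpleModule.jacobson_le_ker Λ Λ Λ M _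
  let q (m : M) : (Λ ⧸ Ring.jacobson Λ) →ₗ[Λ] M := (Ring.jacobson Λ).liftQ _ (hle m)
  have hq : ∀ (m : M) (a : Λ), q m (Ideal.Quotient.mk _ a) = a • m := fun _ _ => rfl
  let Φ : M →ₗ[k] Module.End Λ M :=
    { toFun := fun m => (q m ∘ₗ Submodule.subtype _) ∘ₗ e.symm.toLinearMap
      map_add' := fun m n => by
        ext x
        obtain ⟨a, ha⟩ := Submodule.Quotient.mk_surjective _ (e.symm x : Λ ⧸ Ring.jacobson Λ)
        simp [← ha, hq]
      map_smul' := fun r m => by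
        ext x
        obtain ⟨a, ha⟩ := Submodule.Quotient.mk_surjective _ (e.symm x : Λ ⧸ Ring.jacobson Λ)
        simp [← ha, hq, smul_comm a r m] }
  have hinj : Function.Injective Φ := by
    rw [← LinearMap.ker_eq_bot, LinearMap.ker_eq_bot']
    intro m hm
    by_contra hne
    have hC : ∀ x ∈ isotypicComponent Λ (Λ ⧸ Ring.jacobson Λ) M, q m x = 0 := fun x hx => by
      simpa [Φ] using LinearMap.congr_fun hm (e ⟨x, hx⟩)
    have hsurj : Function.Surjective (q m) :=
      (LinearMap.surjective_or_eq_zero (q m)).resolve_right fun h0 => hne <| by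
        simpa [hq] using (hq m 1).symm.trans (LinearMap.congr_fun h0 _)
    obtain ⟨D, hD⟩ := exists_isCompl (LinearMap.ker (q m))
    have hDe : Nonempty (D ≃ₗ[Λ] M) :=
      ⟨(Submodule.quotientEquivOfIsCompl _ _ hD).symm.trans
        ((q m).quotKerEquivOfSurjective hsurj)⟩
    have hDC : D ≤ LinearMap.ker (q m) := fun x hx => hC x ((le_sSup (a := D) hDe) hx)
    have hbot : D = ⊥ := by
      have := hD.disjoint.symm le_rfl hDC
      exact le_bot_iff.mp this
    subst hbot
    obtain ⟨f⟩ := hDe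
    have : Nontrivial M := IsSimpleModule.nontrivial Λ M
    exact not_subsingleton M f.symm.toEquiv.subsingleton
  have : Nontrivial M := IsSimpleModule.nontrivial Λ M
  have h1 : Module.finrank k M ≤ Module.finrank k k :=
    LinearMap.finrank_le_finrank_of_injective (f := φ.toLinearMap ∘ₗ Φ)
      (φ.injective.comp hinj)
  rw [Module.finrank_self] at h1
  have h2 : 0 < Module.finrank k M := Module.finrank_pos
  omega

/-- The property of an isomorphism class of being the class of a simple module. -/
def IsoClass.IsSimple [Algebra k Λ] (x : IsoClass k Λ) : Prop :=
  Quotient.lift (fun M : FDMod k Λ => IsSimpleModule Λ M)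
    (fun M N (h : Nonempty (M ≃ₗ[Λ] N)) => propext
      ⟨fun _ => IsSimpleModule.congr h.some.symm, fun _ => IsSimpleModule.congr h.some⟩)
    x

variable (k Λ) in
/-- The underlying set of the structure group: the isomorphism classes of simple modules. -/
def StructureGroup [Algebra k Λ] : Type (u + 1) := {x : IsoClass k Λ // x.IsSimple}

/-- The class of a simple module in the structure group. -/
def FDMod.simpleCls [Algebra k Λ] (M : FDMod k Λ) (hM : IsSimpleModule Λ M) :
    StructureGroup k Λ := ⟨M.cls, hM⟩

theorem isSimple_triv [HopfAlgebra k Λ] : IsSimpleModule Λ (FDMod.triv k Λ) :=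
  isSimple_of_finrank (k := k) _ (Module.finrank_self k)

variable [HopfAlgebra k Λ] [Module.Finite k Λ] [IsSplitAlgebra k Λ] [IsBasicAlgebra k Λ]

theorem isSimple_tensor (M N : FDMod k Λ) (hM : IsSimpleModule Λ M) (hN : IsSimpleModule Λ N) :
    IsSimpleModule Λ (M.tensor N) := by
  refine isSimple_of_finrank (k := k) _ ?_
  change Module.finrank k (M ⊗[k] N) = 1
  rw [Module.finrank_tensorProduct, finrank_of_isSimple M hM, finrank_of_isSimple N hN]

theorem isSimple_dual (M : FDMod k Λ) (hM : IsSimpleModule Λ M) : IsSimpleModule Λ M.dual := by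
  refine isSimple_of_finrank (k := k) _ ?_
  change Module.finrank k (Module.Dual k M) = 1
  rw [Subspace.dual_finrank_eq, finrank_of_isSimple M hM]

theorem dual_tensor_self (M : FDMod k Λ) (hM : IsSimpleModule Λ M) :
    (M.dual.tensor M).cls = (FDMod.triv k Λ).cls := by
  have h1 : IsSimpleModule Λ (M.dual.tensor M) := isSimple_tensor _ _ (isSimple_dual M hM) hM
  have h2 : IsSimpleModule Λ (FDMod.triv k Λ) := isSimple_triv
  let f : M.dual.tensor M →ₗ[Λ] FDMod.triv k Λ := dualEval
  have hf : f ≠ 0 := by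
    have : Nontrivial M := IsSimpleModule.nontrivial Λ M
    obtain ⟨m, hm⟩ := exists_ne (0 : M)
    obtain ⟨φ, hφ⟩ := (Module.forall_dual_apply_eq_zero_iff k m).not.mpr hm |> not_forall.mp
    intro h0
    exact hφ (LinearMap.congr_fun h0 (tmk k Λ (show DualMod k Λ M from φ) m))
  exact cls_eq (LinearEquiv.ofBijective f (LinearMap.bijective_of_ne_zero hf))

/-- The structure group: isomorphism classes of simple modules under the tensor product, with unit
the class of the trivial module and inverse given by the dual. -/
instance : Group (StructureGroup k Λ) where
  mul x y := ⟨x.1 * y.1, by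
    obtain ⟨⟨M⟩, hM⟩ := x
    obtain ⟨⟨N⟩, hN⟩ := y
    exact isSimple_tensor M N hM hN⟩
  one := (FDMod.triv k Λ).simpleCls isSimple_triv
  inv x := ⟨Quotient.map FDMod.dual (fun M N (h : Nonempty (M ≃ₗ[Λ] N)) => ⟨dualCongr h.some⟩) x.1, by
    obtain ⟨⟨M⟩, hM⟩ := x
    exact isSimple_dual M hM⟩
  mul_assoc x y z := Subtype.ext (mul_assoc x.1 y.1 z.1)
  one_mul x := Subtype.ext (one_mul x.1)
  mul_one x := Subtype.ext (mul_one x.1)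
  inv_mul_cancel x := by
    obtain ⟨⟨M⟩, hM⟩ := x
    exact Subtype.ext (dual_tensor_self M hM)

end Basic

/-! ### Projective covers, composition series and the canonical element -/

section Canonical

variable {k Λ : Type u} [Field k] [Ring Λ]

/-- A projective cover: a projective module with an essential surjection, i.e. a surjection whose
restriction to each strict submodule is not surjective. -/
structure IsProjectiveCover {P M : Type u} [AddCommGroup P] [Module Λ P] [AddCommGroup M]
    [Module Λ M] (ψ : P →ₗ[Λ] M) : Prop where
  projective : Module.Projective Λ P
  surjective : Function.Surjective ψ
  essential : ∀ X : Submodule Λ P, X.map ψ = ⊤ → X = ⊤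

instance finite_submodule [Algebra k Λ] (M : FDMod k Λ) (N : Submodule Λ M) : Module.Finite k N :=
  inferInstanceAs (Module.Finite k (N.restrictScalars k))

instance finite_submodule_quotient [Algebra k Λ] (M : FDMod k Λ) (N : Submodule Λ M)
    (L : Submodule Λ N) : Module.Finite k (N ⧸ L) :=
  Module.Finite.of_surjective (L.mkQ.restrictScalars k) L.mkQ_surjective

theorem exists_projectiveCover [Algebra k Λ] [Module.Finite k Λ] (M : FDMod k Λ) :
    ∃ (P : FDMod k Λ) (ψ : P →ₗ[Λ] M), IsProjectiveCover ψ := by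
  classical
  have hex : ∃ n, ∃ (P : FDMod k Λ) (ψ : P →ₗ[Λ] M), Module.Projective Λ P ∧
      Function.Surjective ψ ∧ Module.finrank k P = n := by
    have : Module.Finite Λ M := Module.Finite.of_restrictScalars_finite k Λ M
    obtain ⟨n, f, hf⟩ := Module.Finite.exists_fin' Λ M
    exact ⟨_, ⟨Fin n → Λ⟩, f, inferInstanceAs (Module.Projective Λ (Fin n → Λ)), hf, rfl⟩
  obtain ⟨P, ψ, hP, hψ, hn⟩ := Nat.find_spec hex
  refine ⟨P, ψ, hP, hψ, fun X hX => ?_⟩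
  have hXs : Function.Surjective (ψ ∘ₗ X.subtype) := by
    rw [← LinearMap.range_eq_top, LinearMap.range_comp, Submodule.range_subtype, hX]
  obtain ⟨f, hf⟩ := Module.projective_lifting_property (ψ ∘ₗ X.subtype) ψ hXs
  let g : Module.End Λ P := X.subtype ∘ₗ f
  have hg : ∀ p, ψ (g p) = ψ p := fun p => LinearMap.congr_fun hf p
  have hgn : ∀ (n : ℕ) p, ψ ((g ^ n) p) = ψ p := by
    intro n
    induction n with
    | zero => intro p; rfl
    | succ n ih => intro p; rw [pow_succ, Module.End.mul_apply, ih, hg]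
  have : IsArtinianRing Λ := IsArtinianRing.of_finite k Λ
  have : Module.Finite Λ P := Module.Finite.of_restrictScalars_finite k Λ P
  obtain ⟨n, hc, hn1⟩ :=
    (g.eventually_isCompl_ker_pow_range_pow.and (Filter.eventually_ge_atTop 1)).exists
  have hproj : Module.Projective Λ (LinearMap.range (g ^ n)) :=
    Module.Projective.of_split (Submodule.subtype _)
      (Submodule.projectionOnto _ _ hc.symm)
      (Submodule.projectionOnto_comp_subtype hc.symm)
  have hmin := Nat.find_min' hex
    ⟨⟨LinearMap.range (g ^ n)⟩, ψ ∘ₗ Submodule.subtype _, hproj, fun m => by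
      obtain ⟨p, rfl⟩ := hψ m
      exact ⟨⟨(g ^ n) p, LinearMap.mem_range_self _ _⟩, hgn n p⟩, rfl⟩
  rw [← hn] at hmin
  have htop : (LinearMap.range (g ^ n)).restrictScalars k = ⊤ :=
    Submodule.eq_top_of_finrank_eq (le_antisymm (Submodule.finrank_le _) hmin)
  rw [eq_top_iff]
  intro p _
  have hp : p ∈ (LinearMap.range (g ^ n)).restrictScalars k := htop ▸ Submodule.mem_top
  obtain ⟨q, rfl⟩ := hp
  obtain ⟨m, rfl⟩ := Nat.exists_eq_add_of_le' hn1
  rw [pow_succ', Module.End.mul_apply]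
  exact (f _).2

/-- The `i`-th factor of a composition series, as a finite dimensional module. -/
def compositionFactor [Algebra k Λ] (M : FDMod k Λ) (s : CompositionSeries (Submodule Λ M))
    (i : Fin s.length) : FDMod k Λ :=
  ⟨s i.succ ⧸ (s i.castSucc).comap (s i.succ).subtype⟩

theorem isSimple_compositionFactor [Algebra k Λ] (M : FDMod k Λ)
    (s : CompositionSeries (Submodule Λ M)) (i : Fin s.length) :
    IsSimpleModule Λ (compositionFactor M s i) :=
  (covBy_iff_quot_is_simple (s.step i).le).mp (s.step i)

theorem exists_compositionSeries [Algebra k Λ] [Module.Finite k Λ] (M : FDMod k Λ) :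
    ∃ s : CompositionSeries (Submodule Λ M), s.head = ⊥ ∧ s.last = ⊤ := by
  have : IsArtinianRing Λ := IsArtinianRing.of_finite k Λ
  have : Module.Finite Λ M := Module.Finite.of_restrictScalars_finite k Λ M
  exact exists_compositionSeries_of_isNoetherian_isArtinian Λ M

/-- The dimension vector of `M`: the sum in `ℤ𝒮` of the classes of the factors of a
composition series of `M` (by the Jordan-Hölder theorem the chosen series does not matter). -/
def dimVector [Algebra k Λ] [Module.Finite k Λ] (M : FDMod k Λ) :
    MonoidAlgebra ℤ (StructureGroup k Λ) :=
  ∑ i, MonoidAlgebra.single ((compositionFactor M (exists_compositionSeries M).choose i).simpleCls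
    (isSimple_compositionFactor M _ i)) 1

variable (k Λ) in
/-- The canonical element `c`: the dimension vector of the projective cover of the trivial
module. -/
def canonicalElement [HopfAlgebra k Λ] [Module.Finite k Λ] :
    MonoidAlgebra ℤ (StructureGroup k Λ) :=
  dimVector (exists_projectiveCover (FDMod.triv k Λ)).choose

end Canonical

/-! ### The ring structure on `A ⊕ A` -/

/-- For `c : A`, the group `A ⊕ A` with the multiplication
`(s₁, t₁) (s₂, t₂) = (s₁ s₂, s₁ t₂ + t₁ s₂ + t₁ c t₂)`. -/
@[ext]
structure TwistedSum {A : Type*} [Ring A] (c : A) where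
  fst : A
  snd : A

namespace TwistedSum

variable {A : Type*} [Ring A] {c : A}

instance : Add (TwistedSum c) := ⟨fun x y => ⟨x.fst + y.fst, x.snd + y.snd⟩⟩

instance : Mul (TwistedSum c) :=
  ⟨fun x y => ⟨x.fst * y.fst, x.fst * y.snd + x.snd * y.fst + x.snd * c * y.snd⟩⟩

end TwistedSum

end HopfK

end

noncomputable section

namespace HopfK

/-! ### Functoriality of the tensor product -/

section TensorMap

variable {k Λ : Type u} [Field k] [Ring Λ] [HopfAlgebra k Λ]

/-! Simple modules over a basic split algebra are one-dimensional, so each simple `T` is invertible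
under the tensor product and tensoring with `T` on either side is an autoequivalence. It therefore
preserves projectives, and comparing dimensions shows that it carries projective covers to
projective covers (`nonempty_cover_tensor`, `nonempty_tensor_cover`). Writing `P` for the projective
cover of `k_ε`, this gives `[P_S] = [S][P] = [P][S]`; in particular `[P]` commutes with the image of
`ℤ𝒮`.

Tensoring `P` with a composition series of a module gives projective factors, hence split sequences
(`toK0_mul_eq_sum`). Applied to `P` itself this yields `[P]² = c[P]`. These two relations say
exactly that `(s, t) ↦ s + t[P]` is multiplicative for the twisted product (`twistedSumMap_mul`).
Its image is the projective class ring, since semisimple modules are sums of simple ones and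
projective modules are sums of covers `P_S` (`K0p_eq_twistedSumRange`).

Injectivity (`twistedSumMap_injective`) replaces Krull-Schmidt by two families of additive functions
on `K₀(Λ)`. One detects `P_S` as a direct summand; it vanishes on simple modules because none is
projective when `Λ` is not semisimple (`isSemisimpleRing_of_projective`), so it recovers the
coefficients of `t`. Once `t = 0`, the function `M ↦ dim Hom(M, S)` recovers the coefficients of
`s`. -/

/-- The tensor product of two homomorphisms. -/
def FDMod.tensorMap {M N M' N' : FDMod k Λ} (f : M →ₗ[Λ] M') (g : N →ₗ[Λ] N') :
    M.tensor N →ₗ[Λ] M'.tensor N' :=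
  { (TensorProduct.map (f.restrictScalars k) (g.restrictScalars k)).toAddMonoidHom with
    map_smul' := map_tensorAction
      (TensorProduct.map (f.restrictScalars k) (g.restrictScalars k))
      (fun a => (tensorAction k Λ M' N' a).toAddMonoidHom) fun a m n => by
        simp only [LinearMap.toAddMonoidHom_coe, TensorProduct.map_tmul, tensorAction_tmul]
        induction Coalgebra.comul (R := k) a using TensorProduct.induction_on with
        | zero => simp
        | tmul x y => simp
        | add x y hx hy => simp only [map_add, hx, hy] }

open FDMod

/-- A pure tensor. -/
def FDMod.tmul {M N : FDMod k Λ} (m : M) (n : N) : M.tensor N := tmk k Λ m n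

@[elab_as_elim]
theorem FDMod.tensor_induction {M N : FDMod k Λ} {motive : M.tensor N → Prop} (t : M.tensor N)
    (zero : motive 0) (tmul : ∀ (m : M) (n : N), motive (tmul m n))
    (add : ∀ x y, motive x → motive y → motive (x + y)) : motive t :=
  TensorProduct.induction_on (motive := motive) t zero tmul add

theorem tensorMap_tmul {M N M' N' : FDMod k Λ} (f : M →ₗ[Λ] M') (g : N →ₗ[Λ] N') (m : M) (n : N) :
    tensorMap f g (tmul m n) = tmul (f m) (g n) := rfl

theorem tensorMap_id (M N : FDMod k Λ) :
    tensorMap (LinearMap.id : M →ₗ[Λ] M) (LinearMap.id : N →ₗ[Λ] N) = LinearMap.id := by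
  ext t
  induction t using FDMod.tensor_induction with
  | zero => simp
  | tmul m n => rfl
  | add x y hx hy => simp only [map_add, hx, hy]

theorem tensorMap_comp {L M N L' M' N' : FDMod k Λ} (g : M →ₗ[Λ] N) (f : L →ₗ[Λ] M)
    (g' : M' →ₗ[Λ] N') (f' : L' →ₗ[Λ] M') :
    tensorMap (g ∘ₗ f) (g' ∘ₗ f') = tensorMap g g' ∘ₗ tensorMap f f' := by
  ext t
  induction t using FDMod.tensor_induction with
  | zero => simp
  | tmul m n => rfl
  | add x y hx hy => simp only [map_add, hx, hy]

theorem tensorMap_surjective {M N M' N' : FDMod k Λ} {f : M →ₗ[Λ] M'} {g : N →ₗ[Λ] N'}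
    (hf : Function.Surjective f) (hg : Function.Surjective g) :
    Function.Surjective (tensorMap f g) :=
  TensorProduct.map_surjective (g := f.restrictScalars k) (g' := g.restrictScalars k) hf hg

/-- The underlying vector space of `M` is flat over the field `k`. -/
theorem tensorMap_injective {M N N' : FDMod k Λ} {g : N →ₗ[Λ] N'} (hg : Function.Injective g) :
    Function.Injective (tensorMap (LinearMap.id : M →ₗ[Λ] M) g) :=
  Module.Flat.lTensor_preserves_injective_linearMap (R := k) (M := M) (g.restrictScalars k) hg

theorem tensorMap_exact {M A B C : FDMod k Λ} {f : A →ₗ[Λ] B} {g : B →ₗ[Λ] C}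
    (hfg : Function.Exact f g) (hg : Function.Surjective g) :
    Function.Exact (tensorMap (LinearMap.id : M →ₗ[Λ] M) f)
      (tensorMap (LinearMap.id : M →ₗ[Λ] M) g) :=
  lTensor_exact M (f := f.restrictScalars k) (g := g.restrictScalars k) hfg hg

theorem finrank_tensor (M N : FDMod k Λ) :
    Module.finrank k (M.tensor N) = Module.finrank k M * Module.finrank k N :=
  Module.finrank_tensorProduct (R := k) (S := k) (M := M) (M' := N)

/-- If `U ⊗ T` is trivial then `(M ⊗ U) ⊗ T ≅ M`. -/
def cancelRight {U T : FDMod k Λ} (e : U.tensor T ≃ₗ[Λ] triv k Λ) (M : FDMod k Λ) :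
    (M.tensor U).tensor T ≃ₗ[Λ] M :=
  ((tensorAssoc (k := k) (Λ := Λ) (M := M) (N := U) (P := T)).trans
    (tensorCongr (LinearEquiv.refl Λ M) e)).trans tensorUnitRight

theorem cancelRight_tmul {U T : FDMod k Λ} (e : U.tensor T ≃ₗ[Λ] triv k Λ) {M : FDMod k Λ}
    (m : M) (u : U) (t : T) :
    cancelRight e M (tmul (tmul m u) t) = (show k from e (tmul u t)) • m := rfl

/-- On pure tensors the isomorphism multiplies `m` by the scalar `e (u ⊗ t)`, which does not involve
`M`, so naturality reduces to the `k`-linearity of `f`. -/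
theorem cancelRight_natural {U T : FDMod k Λ} (e : U.tensor T ≃ₗ[Λ] triv k Λ) {M N : FDMod k Λ}
    (f : M →ₗ[Λ] N) (x : (M.tensor U).tensor T) :
    f (cancelRight e M x) =
      cancelRight e N (tensorMap (tensorMap f LinearMap.id) LinearMap.id x) := by
  induction x using FDMod.tensor_induction with
  | zero => simp
  | add x y hx hy => simp only [map_add, hx, hy]
  | tmul y t =>
    induction y using FDMod.tensor_induction with
    | zero =>
      have h : tmul (0 : M.tensor U) t = 0 := TensorProduct.zero_tmul (R := k) (M.tensor U) t
      rw [h]; simp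
    | add x y hx hy =>
      have h : tmul (x + y : M.tensor U) t = tmul x t + tmul y t := TensorProduct.add_tmul x y t
      rw [h]; simp only [map_add, hx, hy]
    | tmul m u =>
      rw [tensorMap_tmul, tensorMap_tmul, cancelRight_tmul, cancelRight_tmul]
      exact (f.restrictScalars k).map_smul _ _

/-- If `T ⊗ U` is trivial then `T ⊗ (U ⊗ M) ≅ M`. -/
def cancelLeft {T U : FDMod k Λ} (e : T.tensor U ≃ₗ[Λ] triv k Λ) (M : FDMod k Λ) :
    T.tensor (U.tensor M) ≃ₗ[Λ] M :=
  ((tensorAssoc (k := k) (Λ := Λ) (M := T) (N := U) (P := M)).symm.trans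
    (tensorCongr e (LinearEquiv.refl Λ M))).trans tensorUnitLeft

theorem cancelLeft_tmul {T U : FDMod k Λ} (e : T.tensor U ≃ₗ[Λ] triv k Λ) {M : FDMod k Λ}
    (m : M) (u : U) (t : T) :
    cancelLeft e M (tmul t (tmul u m)) = (show k from e (tmul t u)) • m := rfl

theorem cancelLeft_natural {T U : FDMod k Λ} (e : T.tensor U ≃ₗ[Λ] triv k Λ) {M N : FDMod k Λ}
    (f : M →ₗ[Λ] N) (x : T.tensor (U.tensor M)) :
    f (cancelLeft e M x) =
      cancelLeft e N (tensorMap LinearMap.id (tensorMap LinearMap.id f) x) := by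
  induction x using FDMod.tensor_induction with
  | zero => simp
  | add x y hx hy => simp only [map_add, hx, hy]
  | tmul t y =>
    induction y using FDMod.tensor_induction with
    | zero =>
      have h : tmul t (0 : U.tensor M) = 0 := TensorProduct.tmul_zero (R := k) (U.tensor M) t
      rw [h]; simp
    | add x y hx hy =>
      have h : tmul t (x + y : U.tensor M) = tmul t x + tmul t y := TensorProduct.tmul_add t x y
      rw [h]; simp only [map_add, hx, hy]
    | tmul u m =>
      rw [tensorMap_tmul, tensorMap_tmul, cancelLeft_tmul, cancelLeft_tmul]
      exact (f.restrictScalars k).map_smul _ _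

end TensorMap

/-! ### Projective modules -/

section Projective

variable {k Λ : Type u} [Field k] [Ring Λ]

/-- An autoequivalence preserves projective modules. -/
theorem projective_of_equivalence [Algebra k Λ] [Module.Finite k Λ] (F G : FDMod k Λ → FDMod k Λ)
    (mapF : ∀ {M N : FDMod k Λ}, (M →ₗ[Λ] N) → (F M →ₗ[Λ] F N))
    (mapG : ∀ {M N : FDMod k Λ}, (M →ₗ[Λ] N) → (G M →ₗ[Λ] G N))
    (mapF_id : ∀ M : FDMod k Λ, mapF (LinearMap.id : M →ₗ[Λ] M) = LinearMap.id)
    (mapF_comp : ∀ {L M N : FDMod k Λ} (g : M →ₗ[Λ] N) (f : L →ₗ[Λ] M),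
      mapF (g ∘ₗ f) = mapF g ∘ₗ mapF f)
    (mapG_surj : ∀ {M N : FDMod k Λ} (f : M →ₗ[Λ] N), Function.Surjective f →
      Function.Surjective (mapG f))
    (ρ : ∀ M, F (G M) ≃ₗ[Λ] M)
    (hρ : ∀ {M N : FDMod k Λ} (f : M →ₗ[Λ] N) (x : F (G M)), f (ρ M x) = ρ N (mapF (mapG f) x))
    (P : FDMod k Λ) (υ : G (F P) ≃ₗ[Λ] P) [Module.Projective Λ P] :
    Module.Projective Λ (F P) := by
  have : Module.Finite Λ (F P) := Module.Finite.of_restrictScalars_finite k Λ (F P)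
  -- Projectivity of `F P` amounts to splitting a surjection from a free module. The splitting is
  -- found after applying `G`, where the target becomes the projective module `P`.
  obtain ⟨n, g, hg⟩ := Module.Finite.exists_fin' Λ (F P)
  let A : FDMod k Λ := ⟨Fin n → Λ⟩
  have : Module.Projective Λ A := inferInstanceAs (Module.Projective Λ (Fin n → Λ))
  let g' : A →ₗ[Λ] F P := g
  obtain ⟨s, hs⟩ := Module.projective_lifting_property (υ.toLinearMap ∘ₗ mapG g') LinearMap.id
    (υ.surjective.comp (mapG_surj g' hg))
  have hs' : mapG g' ∘ₗ s ∘ₗ υ.toLinearMap = LinearMap.id := by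
    ext x
    exact υ.injective (LinearMap.congr_fun hs (υ x))
  -- Applying `F` to the section and conjugating by `ρ` returns to the original surjection;
  -- naturality of `ρ` turns `F (G g')` back into `g'`.
  refine Module.Projective.of_split
    ((ρ A).toLinearMap ∘ₗ mapF (s ∘ₗ υ.toLinearMap) ∘ₗ (ρ (F P)).symm.toLinearMap) g' ?_
  ext x
  simp only [LinearMap.comp_apply, LinearEquiv.coe_coe, hρ]
  rw [← LinearMap.comp_apply, ← mapF_comp, hs', mapF_id]
  simp

/-- The image of any lift of `π` through `ψ` still maps onto `M`, so it is all of `P` because `ψ` is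
essential. -/
theorem IsProjectiveCover.exists_surjective {P M Q : Type u} [AddCommGroup P] [Module Λ P]
    [AddCommGroup M] [Module Λ M] [AddCommGroup Q] [Module Λ Q] {ψ : P →ₗ[Λ] M}
    (hψ : IsProjectiveCover ψ) [Module.Projective Λ Q] (π : Q →ₗ[Λ] M)
    (hπ : Function.Surjective π) : ∃ f : Q →ₗ[Λ] P, Function.Surjective f ∧ ψ ∘ₗ f = π := by
  obtain ⟨f, hf⟩ := Module.projective_lifting_property ψ π hψ.surjective
  refine ⟨f, LinearMap.range_eq_top.mp (hψ.essential _ ?_), hf⟩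
  rw [← LinearMap.range_comp, hf, LinearMap.range_eq_top.mpr hπ]

theorem nonempty_equiv_of_surjective [Algebra k Λ] {M N : FDMod k Λ} (f : M →ₗ[Λ] N)
    (hf : Function.Surjective f) (h : Module.finrank k M ≤ Module.finrank k N) :
    Nonempty (M ≃ₗ[Λ] N) := by
  have h' := le_antisymm h
    (LinearMap.finrank_le_finrank_of_surjective (f := f.restrictScalars k) hf)
  exact ⟨LinearEquiv.ofBijective f ⟨(LinearMap.injective_iff_surjective_of_finrank_eq_finrank
    (f := f.restrictScalars k) h').mpr hf, hf⟩⟩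

theorem finrank_le_of_surjective [Algebra k Λ] {M N : FDMod k Λ} (f : M →ₗ[Λ] N)
    (hf : Function.Surjective f) : Module.finrank k N ≤ Module.finrank k M :=
  LinearMap.finrank_le_finrank_of_surjective (f := f.restrictScalars k) hf

/-- The composite of a projective cover with an isomorphism. -/
theorem IsProjectiveCover.trans_equiv {P M N : Type u} [AddCommGroup P] [Module Λ P]
    [AddCommGroup M] [Module Λ M] [AddCommGroup N] [Module Λ N] {ψ : P →ₗ[Λ] M}
    (hψ : IsProjectiveCover ψ) (e : M ≃ₗ[Λ] N) : IsProjectiveCover (e.toLinearMap ∘ₗ ψ) where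
  projective := hψ.projective
  surjective := e.surjective.comp hψ.surjective
  essential X hX := hψ.essential X <| by
    rw [Submodule.map_comp] at hX
    exact Submodule.map_injective_of_injective e.injective
      (hX.trans (by rw [Submodule.map_top, LinearEquiv.range]))

end Projective

/-! ### Tensoring projective modules with simple modules -/

section TensorSimple

open FDMod

variable {k Λ : Type u} [Field k] [Ring Λ] [HopfAlgebra k Λ] [Module.Finite k Λ]

theorem projective_tensor_right {T U : FDMod k Λ} (e : U.tensor T ≃ₗ[Λ] triv k Λ)
    (e' : T.tensor U ≃ₗ[Λ] triv k Λ) (P : FDMod k Λ) [Module.Projective Λ P] :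
    Module.Projective Λ (P.tensor T) :=
  projective_of_equivalence (fun M => M.tensor T) (fun M => M.tensor U)
    (fun f => tensorMap f LinearMap.id) (fun f => tensorMap f LinearMap.id)
    (fun M => tensorMap_id M T) (fun g f => tensorMap_comp g f LinearMap.id LinearMap.id)
    (fun _ hf => tensorMap_surjective hf Function.surjective_id) (cancelRight e)
    (fun f x => cancelRight_natural e f x) P (cancelRight e' P)

theorem projective_tensor_left {T U : FDMod k Λ} (e : U.tensor T ≃ₗ[Λ] triv k Λ)
    (e' : T.tensor U ≃ₗ[Λ] triv k Λ) (P : FDMod k Λ) [Module.Projective Λ P] :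
    Module.Projective Λ (T.tensor P) :=
  projective_of_equivalence (fun M => T.tensor M) (fun M => U.tensor M)
    (fun f => tensorMap LinearMap.id f) (fun f => tensorMap LinearMap.id f)
    (fun M => tensorMap_id T M) (fun g f => tensorMap_comp LinearMap.id LinearMap.id g f)
    (fun _ hf => tensorMap_surjective Function.surjective_id hf) (cancelLeft e')
    (fun f x => cancelLeft_natural e' f x) P (cancelLeft e P)

variable [IsBasicAlgebra k Λ] [IsSplitAlgebra k Λ]

/-- The inverse is the dual. Evaluation trivializes `T^* ⊗ T`; the opposite order needs no
coevaluation map, because a left inverse in the structure group is two-sided. -/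
theorem exists_tensor_inverse (T : FDMod k Λ) (hT : IsSimpleModule Λ T) :
    ∃ U : FDMod k Λ, IsSimpleModule Λ U ∧ Nonempty (U.tensor T ≃ₗ[Λ] triv k Λ) ∧
      Nonempty (T.tensor U ≃ₗ[Λ] triv k Λ) := by
  refine ⟨T.dual, isSimple_dual T hT, Quotient.exact (dual_tensor_self T hT), ?_⟩
  have h : T.simpleCls hT * (T.simpleCls hT)⁻¹ = 1 := mul_inv_cancel _
  exact Quotient.exact (Subtype.ext_iff.mp h)

theorem tensor_simple_projective (P T : FDMod k Λ) (hP : Module.Projective Λ P)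
    (hT : IsSimpleModule Λ T) : Module.Projective Λ (P.tensor T) := by
  obtain ⟨U, -, ⟨e⟩, ⟨e'⟩⟩ := exists_tensor_inverse T hT
  exact projective_tensor_right e e' P

theorem simple_tensor_projective (P T : FDMod k Λ) (hP : Module.Projective Λ P)
    (hT : IsSimpleModule Λ T) : Module.Projective Λ (T.tensor P) := by
  obtain ⟨U, -, ⟨e⟩, ⟨e'⟩⟩ := exists_tensor_inverse T hT
  exact projective_tensor_left e e' P

/-- The projective cover of `S ⊗ T`, for `T` simple, is `P_S ⊗ T`. -/
theorem nonempty_cover_tensor {P S T Q : FDMod k Λ} {ψ : P →ₗ[Λ] S} (hψ : IsProjectiveCover ψ)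
    (hT : IsSimpleModule Λ T) {φ : Q →ₗ[Λ] S.tensor T} (hφ : IsProjectiveCover φ) :
    Nonempty (P.tensor T ≃ₗ[Λ] Q) := by
  obtain ⟨U, hU, ⟨e⟩, ⟨e'⟩⟩ := exists_tensor_inverse T hT
  have := tensor_simple_projective P T hψ.projective hT
  have := tensor_simple_projective Q U hφ.projective hU
  -- Essentiality of `ψ ⊗ T` is not checked directly. There are surjections `P ⊗ T → Q` and, after
  -- tensoring with the inverse `U`, `Q ⊗ U → P`. As `T` and `U` are one-dimensional, the dimensions
  -- of `P ⊗ T` and `Q` agree and the first surjection is an isomorphism.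
  obtain ⟨f, hf, -⟩ := hφ.exists_surjective (tensorMap ψ LinearMap.id)
    (tensorMap_surjective hψ.surjective Function.surjective_id)
  obtain ⟨g, hg, -⟩ := hψ.exists_surjective
    ((cancelRight e' S).toLinearMap ∘ₗ tensorMap φ LinearMap.id)
    ((cancelRight e' S).surjective.comp
      (tensorMap_surjective hφ.surjective Function.surjective_id))
  refine nonempty_equiv_of_surjective f hf ?_
  have h := finrank_le_of_surjective g hg
  rw [finrank_tensor, finrank_of_isSimple U hU, mul_one] at h
  rwa [finrank_tensor, finrank_of_isSimple T hT, mul_one]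

/-- The projective cover of `T ⊗ S`, for `T` simple, is `T ⊗ P_S`. -/
theorem nonempty_tensor_cover {P S T Q : FDMod k Λ} {ψ : P →ₗ[Λ] S} (hψ : IsProjectiveCover ψ)
    (hT : IsSimpleModule Λ T) {φ : Q →ₗ[Λ] T.tensor S} (hφ : IsProjectiveCover φ) :
    Nonempty (T.tensor P ≃ₗ[Λ] Q) := by
  obtain ⟨U, hU, ⟨e⟩, ⟨e'⟩⟩ := exists_tensor_inverse T hT
  have := simple_tensor_projective P T hψ.projective hT
  have := simple_tensor_projective Q U hφ.projective hU
  obtain ⟨f, hf, -⟩ := hφ.exists_surjective (tensorMap LinearMap.id ψ)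
    (tensorMap_surjective Function.surjective_id hψ.surjective)
  obtain ⟨g, hg, -⟩ := hψ.exists_surjective
    ((cancelLeft e S).toLinearMap ∘ₗ tensorMap LinearMap.id φ)
    ((cancelLeft e S).surjective.comp
      (tensorMap_surjective Function.surjective_id hφ.surjective))
  refine nonempty_equiv_of_surjective f hf ?_
  have h := finrank_le_of_surjective g hg
  rw [finrank_tensor, finrank_of_isSimple U hU, one_mul] at h
  rwa [finrank_tensor, finrank_of_isSimple T hT, one_mul]

/-- If some simple module is projective, then `Λ` is semisimple. -/
theorem isSemisimpleRing_of_projective (T : FDMod k Λ) (hT : IsSimpleModule Λ T)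
    (hP : Module.Projective Λ T) : IsSemisimpleRing Λ := by
  obtain ⟨U, hU, -, ⟨e⟩⟩ := exists_tensor_inverse T hT
  have := tensor_simple_projective T U hP hU
  have htriv : Module.Projective Λ (triv k Λ) := Module.Projective.of_equiv e
  -- Since `k_ε ≅ T ⊗ U` is projective, so is every simple `S ≅ k_ε ⊗ S`.
  have hsimple : ∀ S : FDMod k Λ, IsSimpleModule Λ S → Module.Projective Λ S := fun S hS => by
    have := tensor_simple_projective (triv k Λ) S htriv hS
    exact Module.Projective.of_equiv
      (show (triv k Λ).tensor S ≃ₗ[Λ] S from tensorUnitLeft (k := k) (M := S))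
  have : IsArtinianRing Λ := IsArtinianRing.of_finite k Λ
  -- If the sum of the simple left ideals were proper, it would lie in a maximal left ideal `I`. The
  -- projective simple module `Λ ⧸ I` then embeds in `Λ` by a section of the quotient map, yet its
  -- image is a simple left ideal and so lies in `I`, where the quotient map vanishes.
  refine IsSemisimpleModule.of_sSup_simples_eq_top (by_contra fun hne => ?_)
  obtain ⟨I, hI, hle⟩ := (eq_top_or_exists_le_coatom _).resolve_left hne
  have hS : IsSimpleModule Λ (Λ ⧸ I) := isSimpleModule_iff_isCoatom.mpr hI
  have : Module.Finite k (Λ ⧸ I) :=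
    Module.Finite.of_surjective (I.mkQ.restrictScalars k) I.mkQ_surjective
  have hproj : Module.Projective Λ (Λ ⧸ I) := hsimple ⟨Λ ⧸ I⟩ hS
  obtain ⟨s, hs⟩ := Module.projective_lifting_property I.mkQ LinearMap.id I.mkQ_surjective
  have hinj : Function.Injective s :=
    Function.LeftInverse.injective (g := I.mkQ) fun x => LinearMap.congr_fun hs x
  have hr : LinearMap.range s ≤ I :=
    le_trans (le_sSup (IsSimpleModule.congr (LinearEquiv.ofInjective s hinj).symm)) hle
  have : Nontrivial (Λ ⧸ I) := IsSimpleModule.nontrivial Λ _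
  obtain ⟨x, hx⟩ := exists_ne (0 : Λ ⧸ I)
  exact hx ((LinearMap.congr_fun hs x).symm.trans
    ((Submodule.Quotient.mk_eq_zero I).mpr (hr ⟨x, rfl⟩)))

end TensorSimple

/-! ### Classes in the Grothendieck ring -/

section Classes

open FDMod

variable {k Λ : Type u} [Field k] [Ring Λ] [HopfAlgebra k Λ]

theorem toK0_congr {M N : FDMod k Λ} (e : M ≃ₗ[Λ] N) : M.toK0 = N.toK0 := by
  rw [toK0, toK0, cls_eq e]

theorem toK0_prod (M N : FDMod k Λ) : (M.prod N).toK0 = M.toK0 + N.toK0 := by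
  rw [← sub_eq_zero, ← sub_sub]
  exact Ideal.Quotient.eq_zero_iff_mem.mpr (AddSubgroup.subset_closure ⟨M, N, rfl⟩)

theorem toK0_tensor (M N : FDMod k Λ) : (M.tensor N).toK0 = M.toK0 * N.toK0 := by
  rw [toK0, toK0, toK0, ← map_mul, FreeAbelianGroup.of_mul_of, cls_mul]

/-- A zero module satisfies `M ≅ M ⊕ M`, so `[M] = [M] + [M]`. -/
theorem toK0_of_subsingleton (M : FDMod k Λ) [Subsingleton M] : M.toK0 = 0 := by
  have e : M ≃ₗ[Λ] M × M :=
    { (0 : M →ₗ[Λ] M × M) with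
      invFun := 0
      left_inv := fun _ => Subsingleton.elim _ _
      right_inv := fun _ => Subsingleton.elim _ _ }
  have h := toK0_prod M M
  rw [← toK0_congr (show M ≃ₗ[Λ] M.prod M from e)] at h
  exact left_eq_add.mp h

theorem toK0_of_exact {A B C : FDMod k Λ} {f : A →ₗ[Λ] B} {g : B →ₗ[Λ] C}
    (hf : Function.Injective f) (hfg : Function.Exact f g) (hg : Function.Surjective g)
    [Module.Projective Λ C] : B.toK0 = A.toK0 + C.toK0 := by
  obtain ⟨l, hl⟩ := Module.projective_lifting_property g LinearMap.id hg
  rw [← toK0_prod]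
  exact toK0_congr (hfg.splitSurjectiveEquiv hf ⟨l, hl⟩).1

theorem StructureGroup.exists_rep (x : StructureGroup k Λ) :
    ∃ (S : FDMod k Λ) (hS : IsSimpleModule Λ S), S.simpleCls hS = x := by
  obtain ⟨⟨S⟩, hS⟩ := x
  exact ⟨S, hS, rfl⟩

/-! ### Relations satisfied by the class of the projective cover of the trivial module -/

variable [Module.Finite k Λ]

/-- The projective cover of the trivial module. -/
def trivCover (k Λ : Type u) [Field k] [Ring Λ] [HopfAlgebra k Λ] [Module.Finite k Λ] :
    FDMod k Λ := (exists_projectiveCover (triv k Λ)).choose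

theorem exists_isProjectiveCover_trivCover :
    ∃ ψ : trivCover k Λ →ₗ[Λ] triv k Λ, IsProjectiveCover ψ :=
  (exists_projectiveCover (triv k Λ)).choose_spec

variable [IsBasicAlgebra k Λ] [IsSplitAlgebra k Λ]

/-- Tensoring a composition series with a projective module yields split exact sequences. -/
theorem toK0_mul_eq_sum (P M : FDMod k Λ) (hP : Module.Projective Λ P)
    (s : CompositionSeries (Submodule Λ M)) (h0 : s.head = ⊥) (h1 : s.last = ⊤) :
    P.toK0 * M.toK0 = ∑ i, P.toK0 * (compositionFactor M s i).toK0 := by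
  let sub : Submodule Λ M → FDMod k Λ := fun N => ⟨N⟩
  -- The factor is simple, so its tensor product with `P` is projective and the tensored sequence
  -- splits, although the original one need not.
  have hstep : ∀ i : Fin s.length, P.toK0 * (sub (s i.succ)).toK0 =
      P.toK0 * (sub (s i.castSucc)).toK0 + P.toK0 * (compositionFactor M s i).toK0 := by
    intro i
    have hle : s i.castSucc ≤ s i.succ := (s.step i).le
    have := tensor_simple_projective P _ hP (isSimple_compositionFactor M s i)
    let f : sub (s i.castSucc) →ₗ[Λ] sub (s i.succ) := Submodule.inclusion hle
    let g : sub (s i.succ) →ₗ[Λ] compositionFactor M s i := Submodule.mkQ _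
    have hg : Function.Surjective g := Submodule.mkQ_surjective _
    have hfg : Function.Exact f g := by
      rw [LinearMap.exact_iff]
      refine (Submodule.ker_mkQ _).trans ?_
      exact (Submodule.range_inclusion _ _ hle).symm
    rw [← toK0_tensor, ← toK0_tensor, ← toK0_tensor]
    exact toK0_of_exact (tensorMap_injective (Submodule.inclusion_injective hle))
      (tensorMap_exact hfg hg) (tensorMap_surjective Function.surjective_id hg)
  have key : ∀ (n : ℕ) (hn : n < s.length + 1), P.toK0 * (sub (s ⟨n, hn⟩)).toK0 =
      ∑ i : Fin n, P.toK0 * (compositionFactor M s (i.castLE (by omega))).toK0 := by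
    intro n
    induction n with
    | zero =>
      intro hn
      have hb : s ⟨0, hn⟩ = ⊥ := h0
      have : Subsingleton (sub (s ⟨0, hn⟩)) := by
        rw [hb]; exact inferInstanceAs (Subsingleton (⊥ : Submodule Λ M))
      rw [toK0_of_subsingleton (sub _), mul_zero, Fin.sum_univ_zero]
    | succ n ih =>
      intro hn
      rw [Fin.sum_univ_castSucc]
      exact (hstep ⟨n, by omega⟩).trans (congrArg₂ (· + ·) (ih (by omega)) rfl)
  have htop : sub (s (Fin.last _)) ≃ₗ[Λ] M :=
    (LinearEquiv.ofEq _ _ h1).trans Submodule.topEquiv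
  rw [← toK0_congr htop]
  exact key s.length (by omega)

/-- The ring homomorphism `ℤ𝒮 → K₀(Λ)`. -/
def groupRingHom (k Λ : Type u) [Field k] [Ring Λ] [HopfAlgebra k Λ] [Module.Finite k Λ]
    [IsBasicAlgebra k Λ] [IsSplitAlgebra k Λ] :
    MonoidAlgebra ℤ (StructureGroup k Λ) →ₐ[ℤ] K0 k Λ :=
  MonoidAlgebra.lift ℤ (K0 k Λ) (StructureGroup k Λ)
    { toFun := fun x => Ideal.Quotient.mk (splitIdeal k Λ) (FreeAbelianGroup.of x.1)
      map_one' := rfl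
      map_mul' := fun x y => by rw [← map_mul, FreeAbelianGroup.of_mul_of]; rfl }

theorem groupRingHom_single (S : FDMod k Λ) (hS : IsSimpleModule Λ S) :
    groupRingHom k Λ (MonoidAlgebra.single (S.simpleCls hS) 1) = S.toK0 := by
  rw [groupRingHom, MonoidAlgebra.lift_single, one_smul]
  rfl

/-- `P` covers `S ≅ S ⊗ k_ε`, and so does `S` tensored with the cover of `k_ε`. -/
theorem toK0_cover {S P : FDMod k Λ} (hS : IsSimpleModule Λ S) {ψ : P →ₗ[Λ] S}
    (hψ : IsProjectiveCover ψ) : P.toK0 = S.toK0 * (trivCover k Λ).toK0 := by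
  obtain ⟨φ, hφ⟩ := exists_isProjectiveCover_trivCover (k := k) (Λ := Λ)
  obtain ⟨e⟩ := nonempty_tensor_cover hφ hS (hψ.trans_equiv
    (show S ≃ₗ[Λ] S.tensor (triv k Λ) from (tensorUnitRight (k := k) (M := S)).symm))
  rw [← toK0_tensor, toK0_congr e]

theorem toK0_cover' {S P : FDMod k Λ} (hS : IsSimpleModule Λ S) {ψ : P →ₗ[Λ] S}
    (hψ : IsProjectiveCover ψ) : P.toK0 = (trivCover k Λ).toK0 * S.toK0 := by
  obtain ⟨φ, hφ⟩ := exists_isProjectiveCover_trivCover (k := k) (Λ := Λ)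
  obtain ⟨e⟩ := nonempty_cover_tensor hφ hS (hψ.trans_equiv
    (show S ≃ₗ[Λ] (triv k Λ).tensor S from (tensorUnitLeft (k := k) (M := S)).symm))
  rw [← toK0_tensor, toK0_congr e]

/-- For a basis element `[S]` both products equal `[P_S]`, even when `𝒮` is not abelian. -/
theorem trivCover_mul_groupRingHom (t : MonoidAlgebra ℤ (StructureGroup k Λ)) :
    (trivCover k Λ).toK0 * groupRingHom k Λ t = groupRingHom k Λ t * (trivCover k Λ).toK0 := by
  induction t using MonoidAlgebra.induction_on with
  | of x =>
    obtain ⟨S, hS, rfl⟩ := x.exists_rep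
    obtain ⟨P, ψ, hψ⟩ := exists_projectiveCover S
    change _ * groupRingHom k Λ (MonoidAlgebra.single (S.simpleCls hS) 1) =
      groupRingHom k Λ (MonoidAlgebra.single (S.simpleCls hS) 1) * _
    rw [groupRingHom_single, ← toK0_cover hS hψ, ← toK0_cover' hS hψ]
  | add x y hx hy => rw [map_add, mul_add, add_mul, hx, hy]
  | smul r x hx => rw [map_zsmul, mul_smul_comm, smul_mul_assoc, hx]

/-- Decompose the second factor along the very composition series that defines `canonicalElement`,
then move `[P]` past the image of `c`. -/
theorem trivCover_mul_self :
    (trivCover k Λ).toK0 * (trivCover k Λ).toK0 =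
      groupRingHom k Λ (canonicalElement k Λ) * (trivCover k Λ).toK0 := by
  obtain ⟨φ, hφ⟩ := exists_isProjectiveCover_trivCover (k := k) (Λ := Λ)
  obtain ⟨h0, h1⟩ := (exists_compositionSeries (trivCover k Λ)).choose_spec
  rw [toK0_mul_eq_sum _ _ hφ.projective _ h0 h1, ← trivCover_mul_groupRingHom,
    ← Finset.mul_sum]
  congr 1
  change _ = groupRingHom k Λ (dimVector (trivCover k Λ))
  rw [dimVector, map_sum]
  exact Finset.sum_congr rfl fun i _ => (groupRingHom_single _ _).symm

/-- The map `(s, t) ↦ s + t [P]` to `K₀(Λ)`, with `P` the projective cover of the trivial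
module. -/
def twistedSumMap (x : TwistedSum (canonicalElement k Λ)) : K0 k Λ :=
  groupRingHom k Λ x.fst + groupRingHom k Λ x.snd * (trivCover k Λ).toK0

theorem twistedSumMap_add (x y : TwistedSum (canonicalElement k Λ)) :
    twistedSumMap (x + y) = twistedSumMap x + twistedSumMap y := by
  change groupRingHom k Λ (x.fst + y.fst) + groupRingHom k Λ (x.snd + y.snd) * _ = _
  rw [twistedSumMap, twistedSumMap, map_add, map_add, add_mul]
  abel

theorem twistedSumMap_mul (x y : TwistedSum (canonicalElement k Λ)) :
    twistedSumMap (x * y) = twistedSumMap x * twistedSumMap y := by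
  change groupRingHom k Λ (x.fst * y.fst) + groupRingHom k Λ
    (x.fst * y.snd + x.snd * y.fst + x.snd * canonicalElement k Λ * y.snd) * _ = _
  have h1 : groupRingHom k Λ (x.snd * y.fst) * (trivCover k Λ).toK0 =
      groupRingHom k Λ x.snd * (trivCover k Λ).toK0 * groupRingHom k Λ y.fst := by
    rw [mul_assoc, trivCover_mul_groupRingHom, map_mul, mul_assoc]
  -- The source of the twist: `t₁[P]t₂[P] = t₁[P]²t₂ = t₁c[P]t₂ = t₁ct₂[P]`.
  have h2 : groupRingHom k Λ (x.snd * canonicalElement k Λ * y.snd) * (trivCover k Λ).toK0 =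
      groupRingHom k Λ x.snd * (trivCover k Λ).toK0 *
        (groupRingHom k Λ y.snd * (trivCover k Λ).toK0) := by
    rw [map_mul, map_mul, mul_assoc, ← trivCover_mul_groupRingHom, ← mul_assoc,
      mul_assoc (groupRingHom k Λ x.snd) (groupRingHom k Λ _), ← trivCover_mul_self,
      mul_assoc, mul_assoc, mul_assoc, trivCover_mul_groupRingHom]
  rw [twistedSumMap, twistedSumMap, map_add, map_add, add_mul, add_mul, h1, h2, map_mul, map_mul]
  noncomm_ring

end Classes

/-! ### The projective class ring is the image of `ℤ𝒮 ⊕ ℤ𝒮` -/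

section Generation

open FDMod

variable {k Λ : Type u} [Field k] [Ring Λ] [HopfAlgebra k Λ]

theorem finrank_prod (M N : FDMod k Λ) :
    Module.finrank k (M.prod N) = Module.finrank k M + Module.finrank k N :=
  Module.finrank_prod (R := k) (M := M) (M' := N)

/-- A set of classes containing those of the simple modules and closed under addition contains
the classes of all semisimple modules. -/
theorem toK0_mem_of_isSemisimple (H : AddSubgroup (K0 k Λ))
    (hH : ∀ S : FDMod k Λ, IsSimpleModule Λ S → S.toK0 ∈ H) (M : FDMod k Λ)
    (hM : IsSemisimpleModule Λ M) : M.toK0 ∈ H := by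
  induction h : Module.finrank k M using Nat.strong_induction_on generalizing M with
  | _ n ih =>
  subst h
  rcases subsingleton_or_nontrivial M with _ | _
  · rw [toK0_of_subsingleton]; exact zero_mem _
  -- Split off a simple summand; the complement has smaller dimension.
  obtain ⟨S, hS⟩ := IsSemisimpleModule.exists_simple_submodule Λ M
  obtain ⟨C, hC⟩ := exists_isCompl S
  let S' : FDMod k Λ := ⟨S⟩
  let C' : FDMod k Λ := ⟨C⟩
  have e : S'.prod C' ≃ₗ[Λ] M := Submodule.prodEquivOfIsCompl S C hC
  have hn : Module.finrank k S' + Module.finrank k C' = Module.finrank k M := by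
    rw [← finrank_prod, (e.restrictScalars k).finrank_eq]
  have : Nontrivial S' := IsSimpleModule.nontrivial Λ S
  have hpos : 0 < Module.finrank k S' := Module.finrank_pos
  rw [← toK0_congr e, toK0_prod]
  exact add_mem (hH S' hS)
    (ih _ (by omega) C' (inferInstanceAs (IsSemisimpleModule Λ C)) rfl)

variable [Module.Finite k Λ]

/-- A set of classes containing those of the projective covers of the simple modules and closed
under addition contains the classes of all projective modules. -/
theorem toK0_mem_of_projective (H : AddSubgroup (K0 k Λ))
    (hH : ∀ (S P : FDMod k Λ) (ψ : P →ₗ[Λ] S), IsSimpleModule Λ S → IsProjectiveCover ψ →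
      P.toK0 ∈ H) (M : FDMod k Λ) (hM : Module.Projective Λ M) : M.toK0 ∈ H := by
  induction h : Module.finrank k M using Nat.strong_induction_on generalizing M with
  | _ n ih =>
  subst h
  rcases subsingleton_or_nontrivial M with _ | _
  · rw [toK0_of_subsingleton]; exact zero_mem _
  have : Module.Finite Λ M := Module.Finite.of_restrictScalars_finite k Λ M
  obtain ⟨N, hN⟩ := IsCoatomic.exists_coatom (α := Submodule Λ M)
  have : Module.Finite k (M ⧸ N) :=
    Module.Finite.of_surjective (N.mkQ.restrictScalars k) N.mkQ_surjective
  let S : FDMod k Λ := ⟨M ⧸ N⟩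
  have hS : IsSimpleModule Λ S := isSimpleModule_iff_isCoatom.mpr hN
  -- As `M` is projective and maps onto `S`, it maps onto the cover of `S`. That map splits, so its
  -- kernel is a projective module of smaller dimension.
  obtain ⟨P, ψ, hψ⟩ := exists_projectiveCover S
  obtain ⟨f, hf, -⟩ := hψ.exists_surjective (show M →ₗ[Λ] S from N.mkQ) N.mkQ_surjective
  have := hψ.projective
  let K : FDMod k Λ := ⟨LinearMap.ker f⟩
  let ι : K →ₗ[Λ] M := (LinearMap.ker f).subtype
  have hι : Function.Exact ι f := LinearMap.exact_subtype_ker_map f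
  obtain ⟨l, hl⟩ := Module.projective_lifting_property f LinearMap.id hf
  obtain ⟨e, he, -⟩ := hι.splitSurjectiveEquiv (Submodule.subtype_injective _) ⟨l, hl⟩
  have hK : Module.Projective Λ K := by
    refine Module.Projective.of_split ι (LinearMap.fst Λ K P ∘ₗ e.toLinearMap) ?_
    ext x
    rw [he]
    simp
  have e' : M ≃ₗ[Λ] K.prod P := e
  have hn : Module.finrank k M = Module.finrank k K + Module.finrank k P := by
    rw [← finrank_prod, (e'.restrictScalars k).finrank_eq]
  have : Nontrivial S := IsSimpleModule.nontrivial Λ S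
  have : Nontrivial P := hψ.surjective.nontrivial
  have hpos : 0 < Module.finrank k P := Module.finrank_pos
  rw [toK0_congr e', toK0_prod]
  exact add_mem (ih _ (by omega) K hK rfl) (hH S P ψ hS hψ)

variable [IsBasicAlgebra k Λ] [IsSplitAlgebra k Λ]

theorem twistedSumMap_of_simple (S : FDMod k Λ) (hS : IsSimpleModule Λ S) :
    twistedSumMap (k := k) (Λ := Λ) ⟨MonoidAlgebra.single (S.simpleCls hS) 1, 0⟩ = S.toK0 := by
  rw [twistedSumMap, groupRingHom_single, map_zero, zero_mul, add_zero]

theorem twistedSumMap_of_cover {S P : FDMod k Λ} (hS : IsSimpleModule Λ S) {ψ : P →ₗ[Λ] S}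
    (hψ : IsProjectiveCover ψ) :
    twistedSumMap (k := k) (Λ := Λ) ⟨0, MonoidAlgebra.single (S.simpleCls hS) 1⟩ = P.toK0 := by
  rw [twistedSumMap, groupRingHom_single, map_zero, zero_add, toK0_cover hS hψ]

variable (k Λ) in
/-- The image of `ℤ𝒮 ⊕ ℤ𝒮` as a subring. -/
def twistedSumRange : Subring (K0 k Λ) where
  carrier := Set.range twistedSumMap
  zero_mem' := ⟨⟨0, 0⟩, by simp [twistedSumMap]⟩
  one_mem' := ⟨⟨1, 0⟩, by simp [twistedSumMap]⟩
  add_mem' := by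
    rintro _ _ ⟨x, rfl⟩ ⟨y, rfl⟩
    exact ⟨x + y, twistedSumMap_add x y⟩
  mul_mem' := by
    rintro _ _ ⟨x, rfl⟩ ⟨y, rfl⟩
    exact ⟨x * y, twistedSumMap_mul x y⟩
  neg_mem' := by
    rintro _ ⟨x, rfl⟩
    exact ⟨⟨-x.fst, -x.snd⟩, by simp only [twistedSumMap, map_neg, neg_mul]; abel⟩

theorem groupRingHom_mem (t : MonoidAlgebra ℤ (StructureGroup k Λ)) :
    groupRingHom k Λ t ∈ K0p k Λ := by
  induction t using MonoidAlgebra.induction_on with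
  | of x =>
    obtain ⟨S, hS, rfl⟩ := x.exists_rep
    change groupRingHom k Λ (MonoidAlgebra.single (S.simpleCls hS) 1) ∈ _
    rw [groupRingHom_single]
    exact Subring.subset_closure ⟨S, Or.inl inferInstance, rfl⟩
  | add x y hx hy => rw [map_add]; exact add_mem hx hy
  | smul r x hx => rw [map_zsmul]; exact zsmul_mem hx r

/-- Since the image is already closed under products, it suffices that it contains the classes of
semisimple and projective modules, which needs only its additive structure. -/
theorem K0p_eq_twistedSumRange : K0p k Λ = twistedSumRange k Λ := by
  apply le_antisymm
  · refine Subring.closure_le.mpr ?_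
    rintro _ ⟨M, hM | hM, rfl⟩
    · exact toK0_mem_of_isSemisimple (twistedSumRange k Λ).toAddSubgroup
        (fun S hS => ⟨_, twistedSumMap_of_simple S hS⟩) M hM
    · exact toK0_mem_of_projective (twistedSumRange k Λ).toAddSubgroup
        (fun S P ψ hS hψ => ⟨_, twistedSumMap_of_cover hS hψ⟩) M hM
  · rintro _ ⟨x, rfl⟩
    obtain ⟨ψ, hψ⟩ := exists_isProjectiveCover_trivCover (k := k) (Λ := Λ)
    exact add_mem (groupRingHom_mem _) (mul_mem (groupRingHom_mem _)
      (Subring.subset_closure ⟨_, Or.inr hψ.projective, rfl⟩))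

end Generation

/-! ### Additive functions on modules -/

section Functionals

open FDMod

variable {k Λ : Type u} [Field k] [Ring Λ] [HopfAlgebra k Λ]

instance finite_hom (M N : FDMod k Λ) : Module.Finite k (M →ₗ[Λ] N) :=
  Module.Finite.of_injective (LinearMap.restrictScalarsₗ k Λ M N k)
    (LinearMap.restrictScalars_injective k)

/-- An additive function on modules extends to `K₀(Λ)`. -/
theorem exists_additive_extension (μ : FDMod k Λ → ℤ)
    (hiso : ∀ M N : FDMod k Λ, (M ≃ₗ[Λ] N) → μ M = μ N)
    (hadd : ∀ M N : FDMod k Λ, μ (M.prod N) = μ M + μ N) :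
    ∃ F : K0 k Λ →+ ℤ, ∀ M : FDMod k Λ, F M.toK0 = μ M := by
  let F₀ : FreeAbelianGroup (IsoClass k Λ) →+ ℤ :=
    FreeAbelianGroup.lift (Quotient.lift μ fun M N ⟨e⟩ => hiso M N e)
  have hF₀ : ∀ M : FDMod k Λ, F₀ (FreeAbelianGroup.of M.cls) = μ M := fun M =>
    FreeAbelianGroup.lift_apply_of _ _
  have hker : splitRelations k Λ ≤ F₀.ker := by
    refine (AddSubgroup.closure_le _).mpr ?_
    rintro _ ⟨X, Y, rfl⟩
    change F₀ _ = 0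
    rw [map_sub, map_sub, hF₀, hF₀, hF₀, hadd]
    ring
  exact ⟨QuotientAddGroup.lift (splitIdeal k Λ).toAddSubgroup F₀ hker, hF₀⟩

/-- The homomorphisms `f : P → M` such that `ψ g f = 0` for all `g : M → P`. -/
def radHom {P S : FDMod k Λ} (ψ : P →ₗ[Λ] S) (M : FDMod k Λ) : Submodule k (P →ₗ[Λ] M) where
  carrier := {f | ∀ g : M →ₗ[Λ] P, ψ ∘ₗ g ∘ₗ f = 0}
  zero_mem' g := by simp
  add_mem' {f f'} hf hf' g := by rw [LinearMap.comp_add, LinearMap.comp_add, hf, hf', add_zero]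
  smul_mem' r f hf g := by
    ext x
    have h := LinearMap.congr_fun (hf g) x
    simp only [LinearMap.comp_apply, LinearMap.smul_apply, LinearMap.zero_apply,
      LinearMap.map_smul_of_tower] at h ⊢
    rw [h, smul_zero]

/-- `radHom` is compatible with direct sums. -/
def radHomProd {P S : FDMod k Λ} (ψ : P →ₗ[Λ] S) (M N : FDMod k Λ) :
    radHom ψ (M.prod N) ≃ₗ[k] radHom ψ M × radHom ψ N where
  toFun f := (⟨LinearMap.fst Λ M N ∘ₗ f.1, fun g => f.2 (g ∘ₗ LinearMap.fst Λ M N)⟩,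
    ⟨LinearMap.snd Λ M N ∘ₗ f.1, fun g => f.2 (g ∘ₗ LinearMap.snd Λ M N)⟩)
  map_add' f f' := rfl
  map_smul' r f := rfl
  invFun f := ⟨LinearMap.prod f.1.1 f.2.1, fun g => by
    let i₁ : M →ₗ[Λ] M.prod N := LinearMap.inl Λ M N
    let i₂ : N →ₗ[Λ] M.prod N := LinearMap.inr Λ M N
    ext x
    have h₁ : ψ (g (i₁ (f.1.1 x))) = 0 := LinearMap.congr_fun (f.1.2 (g ∘ₗ i₁)) x
    have h₂ : ψ (g (i₂ (f.2.1 x))) = 0 := LinearMap.congr_fun (f.2.2 (g ∘ₗ i₂)) x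
    have hx : (show M.prod N from (f.1.1 x, f.2.1 x)) = i₁ (f.1.1 x) + i₂ (f.2.1 x) :=
      Prod.ext (add_zero _).symm (zero_add _).symm
    change ψ (g (show M.prod N from (f.1.1 x, f.2.1 x))) = 0
    rw [hx, map_add, map_add, h₁, h₂, add_zero]⟩
  left_inv f := rfl
  right_inv f := rfl

/-- Isomorphic modules have isomorphic spaces `radHom`. -/
def radHomCongr {P S : FDMod k Λ} (ψ : P →ₗ[Λ] S) {M N : FDMod k Λ} (e : M ≃ₗ[Λ] N) :
    radHom ψ M ≃ₗ[k] radHom ψ N where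
  toFun f := ⟨e.toLinearMap ∘ₗ f.1, fun g => f.2 (g ∘ₗ e.toLinearMap)⟩
  map_add' f f' := by ext x; simp
  map_smul' r f := by ext x; exact LinearMap.map_smul_of_tower e.toLinearMap r (f.1 x)
  invFun f := ⟨e.symm.toLinearMap ∘ₗ f.1, fun g => f.2 (g ∘ₗ e.symm.toLinearMap)⟩
  left_inv f := by ext x; simp
  right_inv f := by ext x; simp

/-- The homomorphisms from a source to isomorphic modules. -/
def homCongrRight (P : FDMod k Λ) {M N : FDMod k Λ} (e : M ≃ₗ[Λ] N) :
    (P →ₗ[Λ] M) ≃ₗ[k] (P →ₗ[Λ] N) where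
  toFun f := e.toLinearMap ∘ₗ f
  map_add' f f' := by ext x; simp
  map_smul' r f := by ext x; exact LinearMap.map_smul_of_tower e.toLinearMap r (f x)
  invFun f := e.symm.toLinearMap ∘ₗ f
  left_inv f := by ext x; simp
  right_inv f := by ext x; simp

/-- The homomorphisms from isomorphic modules to a target. -/
def homCongrLeft (S : FDMod k Λ) {M N : FDMod k Λ} (e : M ≃ₗ[Λ] N) :
    (M →ₗ[Λ] S) ≃ₗ[k] (N →ₗ[Λ] S) where
  toFun f := f ∘ₗ e.symm.toLinearMap
  map_add' _ _ := rfl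
  map_smul' _ _ := rfl
  invFun f := f ∘ₗ e.toLinearMap
  left_inv f := by ext x; simp
  right_inv f := by ext x; simp

theorem exists_finrank_hom (S : FDMod k Λ) :
    ∃ F : K0 k Λ →+ ℤ, ∀ M : FDMod k Λ, F M.toK0 = Module.finrank k (M →ₗ[Λ] S) := by
  refine exists_additive_extension _ (fun M N e => ?_) fun M N => ?_
  · rw [(homCongrLeft S e).finrank_eq]
  · have e : ((M →ₗ[Λ] S) × (N →ₗ[Λ] S)) ≃ₗ[k] (M.prod N →ₗ[Λ] S) := LinearMap.coprodEquiv k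
    rw [← e.finrank_eq, Module.finrank_prod, Nat.cast_add]

/-- When `ψ` is a projective cover of a simple module, this function detects `P` as a direct summand
of `M`: if `ψ g f ≠ 0`, then `g f` is onto by essentiality, hence an automorphism of `P`. -/
theorem exists_finrank_hom_sub_radHom {P S : FDMod k Λ} (ψ : P →ₗ[Λ] S) :
    ∃ F : K0 k Λ →+ ℤ, ∀ M : FDMod k Λ,
      F M.toK0 = Module.finrank k (P →ₗ[Λ] M) - Module.finrank k (radHom ψ M) := by
  refine exists_additive_extension _ (fun M N e => ?_) fun M N => ?_
  · rw [(homCongrRight P e).finrank_eq, (radHomCongr ψ e).finrank_eq]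
  · have e : ((P →ₗ[Λ] M) × (P →ₗ[Λ] N)) ≃ₗ[k] (P →ₗ[Λ] M.prod N) := LinearMap.prodEquiv k
    rw [← e.finrank_eq, (radHomProd ψ M N).finrank_eq, Module.finrank_prod, Module.finrank_prod]
    push_cast
    ring

theorem finrank_hom_simple_ne_zero (S : FDMod k Λ) (hS : IsSimpleModule Λ S) :
    Module.finrank k (S →ₗ[Λ] S) ≠ 0 := by
  have : Nontrivial S := IsSimpleModule.nontrivial Λ S
  have : Nontrivial (S →ₗ[Λ] S) := inferInstanceAs (Nontrivial (Module.End Λ S))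
  exact Module.finrank_pos.ne'

theorem finrank_hom_simple_eq_zero {S T : FDMod k Λ} (hS : IsSimpleModule Λ S)
    (hT : IsSimpleModule Λ T) (h : T.cls ≠ S.cls) : Module.finrank k (T →ₗ[Λ] S) = 0 := by
  have : Subsingleton (T →ₗ[Λ] S) := subsingleton_of_forall_eq 0 fun f => by
    by_contra hf
    exact h (cls_eq (LinearEquiv.ofBijective f (LinearMap.bijective_of_ne_zero hf)))
  exact Module.finrank_zero_of_subsingleton

/-- The identity of `P` is not in `radHom ψ P`, because `ψ ≠ 0`. -/
theorem finrank_radHom_ne {P S : FDMod k Λ} (hS : IsSimpleModule Λ S) {ψ : P →ₗ[Λ] S}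
    (hψ : IsProjectiveCover ψ) :
    (Module.finrank k (P →ₗ[Λ] P) : ℤ) - Module.finrank k (radHom ψ P) ≠ 0 := by
  intro h
  have htop : radHom ψ P = ⊤ := Submodule.eq_top_of_finrank_eq (by omega)
  have hid : LinearMap.id ∈ radHom ψ P := htop ▸ Submodule.mem_top
  have : Nontrivial S := IsSimpleModule.nontrivial Λ S
  obtain ⟨y, hy⟩ := exists_ne (0 : S)
  obtain ⟨x, rfl⟩ := hψ.surjective y
  exact hy (LinearMap.congr_fun (hid LinearMap.id) x)

/-- Up to isomorphism `T` is the only simple quotient of `Q`, so every map `Q → S` vanishes, in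
particular every `ψ g`. -/
theorem finrank_radHom_cover {P S Q T : FDMod k Λ} (hS : IsSimpleModule Λ S)
    (hT : IsSimpleModule Λ T) (h : T.cls ≠ S.cls) (ψ : P →ₗ[Λ] S) {φ : Q →ₗ[Λ] T}
    (hφ : IsProjectiveCover φ) :
    (Module.finrank k (P →ₗ[Λ] Q) : ℤ) - Module.finrank k (radHom ψ Q) = 0 := by
  have hzero : ∀ χ : Q →ₗ[Λ] S, χ = 0 := by
    intro χ
    by_contra hχ
    -- If the image of `ker χ` in the simple module `T` is zero, `φ` factors through `χ` and gives
    -- an isomorphism `S ≅ T`. If it is all of `T`, essentiality forces `ker χ = Q`.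
    rcases eq_bot_or_eq_top ((LinearMap.ker χ).map φ) with hb | ht
    · have hle : LinearMap.ker χ ≤ LinearMap.ker φ :=
        fun x hx => (Submodule.mem_bot Λ).mp (hb ▸ Submodule.mem_map_of_mem hx)
      have hχs := LinearMap.surjective_of_ne_zero hχ
      let ε : S →ₗ[Λ] T := (LinearMap.ker χ).liftQ φ hle ∘ₗ
        (χ.quotKerEquivOfSurjective hχs).symm.toLinearMap
      have hε : ∀ q, ε (χ q) = φ q := fun q => by
        have hq : (χ.quotKerEquivOfSurjective hχs).symm (χ q) =
            (LinearMap.ker χ).mkQ q :=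
          (LinearEquiv.symm_apply_eq _).mpr rfl
        simp [ε, hq]
      have hε0 : ε ≠ 0 := fun h0 => by
        have : Nontrivial T := IsSimpleModule.nontrivial Λ T
        obtain ⟨y, hy⟩ := exists_ne (0 : T)
        obtain ⟨q, rfl⟩ := hφ.surjective y
        exact hy (by rw [← hε, h0, LinearMap.zero_apply])
      exact h (cls_eq (LinearEquiv.ofBijective ε (LinearMap.bijective_of_ne_zero hε0))).symm
    · exact hχ (LinearMap.ker_eq_top.mp (hφ.essential _ ht))
  have htop : radHom ψ Q = ⊤ := eq_top_iff.mpr fun f _ g => by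
    rw [← LinearMap.comp_assoc, hzero (ψ ∘ₗ g), LinearMap.zero_comp]
  rw [htop, finrank_top, sub_self]

/-- If `ψ g f ≠ 0`, then `ψ g` is onto `S`, so `g : T → P` is onto by essentiality and injective
because `T` is simple; thus `T ≅ P` would be projective. -/
theorem finrank_radHom_simple {P S T : FDMod k Λ} (hS : IsSimpleModule Λ S)
    (hT : IsSimpleModule Λ T) (hTP : ¬ Module.Projective Λ T) {ψ : P →ₗ[Λ] S}
    (hψ : IsProjectiveCover ψ) :
    (Module.finrank k (P →ₗ[Λ] T) : ℤ) - Module.finrank k (radHom ψ T) = 0 := by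
  have htop : radHom ψ T = ⊤ := eq_top_iff.mpr fun f _ g => by
    by_contra hne
    have hr : LinearMap.range g = ⊤ := hψ.essential _ <| by
      rw [← LinearMap.range_comp]
      refine LinearMap.range_eq_top.mpr (LinearMap.surjective_of_ne_zero fun h0 => hne ?_)
      rw [← LinearMap.comp_assoc, h0, LinearMap.zero_comp]
    have hg : g ≠ 0 := fun h0 => hne (by rw [h0, LinearMap.zero_comp, LinearMap.comp_zero])
    have := hψ.projective
    exact hTP (Module.Projective.of_equiv (LinearEquiv.ofBijective g
      ⟨LinearMap.injective_of_ne_zero hg, LinearMap.range_eq_top.mp hr⟩).symm)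
  rw [htop, finrank_top, sub_self]

/-! ### Reading off coefficients and injectivity -/

variable [Module.Finite k Λ] [IsBasicAlgebra k Λ] [IsSplitAlgebra k Λ]

/-- Used with `r = 1` to read coefficients on simple modules and with `r = [P]` to read them on
projective covers. -/
theorem apply_groupRingHom_mul (F : K0 k Λ →+ ℤ) (r : K0 k Λ) (x : StructureGroup k Λ)
    (hF : ∀ y ≠ x, F (groupRingHom k Λ (MonoidAlgebra.single y 1) * r) = 0)
    (t : MonoidAlgebra ℤ (StructureGroup k Λ)) :
    F (groupRingHom k Λ t * r) =
      t.coeff x * F (groupRingHom k Λ (MonoidAlgebra.single x 1) * r) := by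
  classical
  induction t using MonoidAlgebra.induction_on with
  | of y =>
    rw [MonoidAlgebra.of_apply]
    by_cases hy : y = x
    · subst hy; simp
    · rw [hF y hy]; simp [hy]
  | add s t hs ht => rw [map_add, add_mul, map_add, hs, ht]; simp [add_mul]
  | smul n t ht =>
    rw [map_zsmul, smul_mul_assoc, map_zsmul, ht, MonoidAlgebra.coeff_smul, Finsupp.smul_apply,
      smul_mul_assoc]

theorem twistedSumMap_injective (hΛ : ¬ IsSemisimpleRing Λ) :
    Function.Injective (twistedSumMap (k := k) (Λ := Λ)) := by
  suffices h : ∀ s t : MonoidAlgebra ℤ (StructureGroup k Λ),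
      groupRingHom k Λ s + groupRingHom k Λ t * (trivCover k Λ).toK0 = 0 → s = 0 ∧ t = 0 by
    intro x y hxy
    obtain ⟨h1, h2⟩ := h (x.fst - y.fst) (x.snd - y.snd) (by
      rw [map_sub, map_sub, sub_mul]
      have := sub_eq_zero.mpr hxy
      rw [twistedSumMap, twistedSumMap] at this
      rw [← this]; abel)
    exact TwistedSum.ext (sub_eq_zero.mp h1) (sub_eq_zero.mp h2)
  intro s t hst
  -- The function attached to the cover of `S` kills the simple part and all other covers, leaving
  -- the coefficient of `t` at `S` times a nonzero integer.
  have ht : t = 0 := by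
    ext x
    obtain ⟨S, hS, rfl⟩ := x.exists_rep
    obtain ⟨P, ψ, hψ⟩ := exists_projectiveCover S
    obtain ⟨F, hF⟩ := exists_finrank_hom_sub_radHom ψ
    have hsimple : ∀ y : StructureGroup k Λ,
        F (groupRingHom k Λ (MonoidAlgebra.single y 1) * 1) = 0 := fun y => by
      obtain ⟨T, hT, rfl⟩ := y.exists_rep
      rw [groupRingHom_single, mul_one, hF]
      exact finrank_radHom_simple hS hT (fun h => hΛ (isSemisimpleRing_of_projective T hT h)) hψ
    have h1 := apply_groupRingHom_mul F 1 (S.simpleCls hS) (fun y _ => hsimple y) s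
    have h2 := apply_groupRingHom_mul F (trivCover k Λ).toK0 (S.simpleCls hS) (fun y hy => by
      obtain ⟨T, hT, rfl⟩ := y.exists_rep
      obtain ⟨Q, φ, hφ⟩ := exists_projectiveCover T
      rw [groupRingHom_single, ← toK0_cover hT hφ, hF]
      exact finrank_radHom_cover hS hT (fun h => hy (Subtype.ext h)) ψ hφ) t
    rw [hsimple, mul_zero, mul_one] at h1
    rw [groupRingHom_single, ← toK0_cover hS hψ, hF] at h2
    have h3 := congrArg F hst
    rw [map_add, map_zero, h1, h2, zero_add] at h3
    exact (mul_eq_zero.mp h3).resolve_right (finrank_radHom_ne hS hψ)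
  subst ht
  refine ⟨?_, rfl⟩
  ext x
  obtain ⟨S, hS, rfl⟩ := x.exists_rep
  -- This function need not vanish on projectives, so it can be used only now that `t = 0`.
  obtain ⟨F, hF⟩ := exists_finrank_hom S
  have h1 := apply_groupRingHom_mul F 1 (S.simpleCls hS) (fun y hy => by
    obtain ⟨T, hT, rfl⟩ := y.exists_rep
    rw [groupRingHom_single, mul_one, hF]
    exact_mod_cast finrank_hom_simple_eq_zero hS hT fun h => hy (Subtype.ext h)) s
  rw [map_zero, zero_mul, add_zero] at hst
  rw [hst, zero_mul, map_zero, groupRingHom_single, mul_one, hF] at h1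
  exact (mul_eq_zero.mp h1.symm).resolve_right
    (by exact_mod_cast finrank_hom_simple_ne_zero S hS)

end Functionals

end HopfK

end

/-! ### The ring isomorphism -/

theorem mainTheorem2 {k Λ : Type u} [Field k] [Ring Λ] [HopfAlgebra k Λ] [Module.Finite k Λ]
    [HopfK.IsBasicAlgebra k Λ] [HopfK.IsSplitAlgebra k Λ] (hΛ : ¬ IsSemisimpleRing Λ) :
    ∃ e : HopfK.K0p k Λ ≃+* HopfK.TwistedSum (HopfK.canonicalElement k Λ),
      (∀ (S : HopfK.FDMod k Λ) (hS : IsSimpleModule Λ S) (x : HopfK.K0p k Λ),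
        (x : HopfK.K0 k Λ) = S.toK0 → e x = ⟨MonoidAlgebra.single (S.simpleCls hS) 1, 0⟩) ∧
      (∀ (S P : HopfK.FDMod k Λ) (hS : IsSimpleModule Λ S) (ψ : P →ₗ[Λ] S)
        (_ : HopfK.IsProjectiveCover ψ) (x : HopfK.K0p k Λ),
        (x : HopfK.K0 k Λ) = P.toK0 → e x = ⟨0, MonoidAlgebra.single (S.simpleCls hS) 1⟩) := by
  let f : HopfK.TwistedSum (HopfK.canonicalElement k Λ) → HopfK.K0p k Λ := fun x =>
    ⟨HopfK.twistedSumMap x, HopfK.K0p_eq_twistedSumRange (k := k) (Λ := Λ) ▸ ⟨x, rfl⟩⟩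
  have hf : Function.Bijective f := by
    refine ⟨fun x y h => HopfK.twistedSumMap_injective hΛ (congrArg Subtype.val h), ?_⟩
    rintro ⟨y, hy⟩
    obtain ⟨x, rfl⟩ := HopfK.K0p_eq_twistedSumRange (k := k) (Λ := Λ) ▸ hy
    exact ⟨x, rfl⟩
  -- `≃+*` requires only the two operations; the ring axioms for the twisted product follow by
  -- transport along this bijection.
  let e : HopfK.TwistedSum (HopfK.canonicalElement k Λ) ≃+* HopfK.K0p k Λ :=
    { Equiv.ofBijective f hf with
      map_mul' := fun x y => Subtype.ext (HopfK.twistedSumMap_mul x y)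
      map_add' := fun x y => Subtype.ext (HopfK.twistedSumMap_add x y) }
  refine ⟨e.symm, fun S hS x hx => ?_, fun S P hS ψ hψ x hx => ?_⟩
  · exact (RingEquiv.symm_apply_eq e).mpr
      (Subtype.ext (hx.trans (HopfK.twistedSumMap_of_simple S hS).symm))
  · exact (RingEquiv.symm_apply_eq e).mpr
      (Subtype.ext (hx.trans (HopfK.twistedSumMap_of_cover hS hψ).symm))
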